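/- Let $\mathfrak g=E_{10}$ be the Kac--Moody algebra over $\mathbb C$ whose Dynkin diagram is the chain $\alpha_{-1}-\alpha_0-\alpha_1-\cdots-\alpha_7$ with one more node $\alpha_8$ joined to $\alpha_5$; let $A=(a_{ij})_{-1\le i,j\le 8}$ be its Cartan matrix, $\mathfrak h$ its (real) Cartan subalgebra with basis the simple coroots $\alpha_i^\vee$, and $\alpha_j\in\mathfrak h^*$ its simple roots, $\alpha_j(\alpha_i^\vee)=a_{ij}$. A root is a nonzero $\gamma\in\mathfrak h^*$ with nonzero root space $\mathfrak g_\gamma$; it is positive if $\gamma=\sum_i k_i\alpha_i$ with all $k_i\in\mathbb Z_{\ge 0}$. The Weyl group $\hat W$ is generated by the simple reflections $r_i(\lambda)=\lambda-\lambda(\alpha_i^\vee)\alpha_i$ ($-1\le i\le 8$), and $W$ denotes its subgroup generated by $r_0,\dots,r_8$ (the Weyl group of $E_9$). A root is real if it is $\hat W$-equivalent to a simple root, and imaginary otherwise. Put $\delta=\alpha_0+2\alpha_1+3\alpha_2+4\alpha_3+5\alpha_4+6\alpha_5+4\alpha_6+2\alpha_7+3\alpha_8$. A root $\gamma=\sum_i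 k_i\alpha_i$ is said to be at affine level $1$ if $k_{-1}=1$ (equivalently $(\gamma|\delta)=-1$, where $(\cdot|\cdot)$ is the bilinear form with $(\alpha_i|\alpha_j)=a_{ij}$). Claim. For every imaginary root $\gamma$ of $E_{10}$ at affine level $1$ there are $w\in\hat W$ and positive real roots $\alpha,\beta$ with $w(\gamma)=\alpha+\beta$. Explicitly: every imaginary root at affine level $1$ is $W$-equivalent to $\alpha_{-1}+n\delta$ for some integer $n\ge 1$. Conversely, for every integer $n\ge 1$, $\alpha_{-1}+n\delta$ is an imaginary root at affine level $1$, both $\alpha_{-1}+\alpha_0+\alpha_1$ and $n\delta-\alpha_1$ are positive real roots, and $$r_0(\alpha_{-1}+n\delta)=(\alpha_{-1}+\alpha_0+\alpha_1)+(n\delta-\alpha_1).$$ -/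

import Mathlib

/-! The Kac-Moody algebra `E₁₀`, its roots and its Weyl group.

The nodes `-1, 0, 1, …, 8` of the Dynkin diagram are indexed by `Fin 10`, the index `i` standing
for the node `i - 1`: the chain `α₋₁ - α₀ - α₁ - … - α₇` has the indices `0, …, 8`, and
the index `9` is the node `α₈`, which is joined to `α₅` (the index `6`). -/

noncomputable section

namespace E10

/-- The Cartan matrix of `E₁₀`. -/
def cartanMatrix : Matrix (Fin 10) (Fin 10) ℤ :=
  !![ 2, -1,  0,  0,  0,  0,  0,  0,  0,  0;
     -1,  2, -1,  0,  0,  0,  0,  0,  0,  0;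
      0, -1,  2, -1,  0,  0,  0,  0,  0,  0;
      0,  0, -1,  2, -1,  0,  0,  0,  0,  0;
      0,  0,  0, -1,  2, -1,  0,  0,  0,  0;
      0,  0,  0,  0, -1,  2, -1,  0,  0,  0;
      0,  0,  0,  0,  0, -1,  2, -1,  0, -1;
      0,  0,  0,  0,  0,  0, -1,  2, -1,  0;
      0,  0,  0,  0,  0,  0,  0, -1,  2,  0;
      0,  0,  0,  0,  0,  0, -1,  0,  0,  2]

/-- The Kac-Moody algebra `E₁₀` over `ℂ`: the Lie algebra with generators `Hᵢ, Eᵢ, Fᵢ` and the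
Chevalley-Serre relations of the Cartan matrix (which is invertible, so that the `Hᵢ = αᵢ^∨`
span the whole Cartan subalgebra). -/
abbrev Algebra : Type := Matrix.ToLieAlgebra ℂ cartanMatrix

/-- The generator `Hᵢ = αᵢ^∨` of `E₁₀`. -/
def genH (i : Fin 10) : Algebra :=
  (LieSubmodule.Quotient.mk (FreeLieAlgebra.of ℂ (CartanMatrix.Generators.H i)) :
    FreeLieAlgebra ℂ (CartanMatrix.Generators (Fin 10)) ⧸
      CartanMatrix.Relations.toIdeal ℂ cartanMatrix)

/-- The real Cartan subalgebra `𝔥`, in coordinates with respect to its basis of the simple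
coroots. -/
abbrev Cartan : Type := Fin 10 → ℝ

/-- The simple coroot `αᵢ^∨ ∈ 𝔥`. -/
def simpleCoroot (i : Fin 10) : Cartan := Pi.single i 1

/-- The map from `𝔥` to the Lie algebra `E₁₀` with `αᵢ^∨ ↦ Hᵢ`. -/
def cartanMap (h : Cartan) : Algebra := ∑ i, ((h i : ℝ) : ℂ) • genH i

/-- The simple root `αⱼ ∈ 𝔥*`, with `αⱼ(αᵢ^∨) = aᵢⱼ`. -/
def simpleRoot (j : Fin 10) : Module.Dual ℝ Cartan :=
  ∑ i, (cartanMatrix i j : ℝ) • LinearMap.proj i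

theorem simpleRoot_simpleCoroot (i j : Fin 10) :
    simpleRoot j (simpleCoroot i) = (cartanMatrix i j : ℝ) := by
  simp [simpleRoot, simpleCoroot, Pi.single_apply]

/-- The root space of `γ ∈ 𝔥*`. -/
def rootSpace (γ : Module.Dual ℝ Cartan) : Submodule ℂ Algebra where
  carrier := {x | ∀ h : Cartan, ⁅cartanMap h, x⁆ = ((γ h : ℝ) : ℂ) • x}
  add_mem' := by
    intro x y hx hy h
    rw [lie_add, hx h, hy h, smul_add]
  zero_mem' := by
    intro h
    rw [lie_zero, smul_zero]
  smul_mem' := by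
    intro c x hx h
    rw [lie_smul, hx h, smul_comm]

/-- The set of roots of `E₁₀`. -/
def roots : Set (Module.Dual ℝ Cartan) := {γ | γ ≠ 0 ∧ rootSpace γ ≠ ⊥}

/-- The element `∑ kᵢ αᵢ` of the root lattice. -/
def latticeVector (k : Fin 10 → ℤ) : Module.Dual ℝ Cartan := ∑ i, k i • simpleRoot i

/-- The positive roots: the roots which are sums `∑ kᵢ αᵢ` with all `kᵢ ≥ 0`. -/
def positiveRoots : Set (Module.Dual ℝ Cartan) :=
  {γ | γ ∈ roots ∧ ∃ k : Fin 10 → ℤ, (∀ i, 0 ≤ k i) ∧ γ = latticeVector k}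

/-- The simple reflection `λ ↦ λ - λ(αᵢ^∨) αᵢ` of `𝔥*`. -/
def simpleReflection (i : Fin 10) : Module.Dual ℝ Cartan ≃ₗ[ℝ] Module.Dual ℝ Cartan :=
  Module.reflection (x := simpleRoot i) (f := Module.Dual.eval ℝ Cartan (simpleCoroot i)) (by
    rw [Module.Dual.eval_apply, simpleRoot_simpleCoroot]
    fin_cases i <;> norm_num [cartanMatrix])

theorem simpleReflection_apply (i : Fin 10) (γ : Module.Dual ℝ Cartan) :
    simpleReflection i γ = γ - γ (simpleCoroot i) • simpleRoot i := by
  simp [simpleReflection, Module.reflection_apply]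

/-- The Weyl group of `E₁₀`, generated by all the simple reflections. -/
def weylGroup : Subgroup (Module.Dual ℝ Cartan ≃ₗ[ℝ] Module.Dual ℝ Cartan) :=
  Subgroup.closure (Set.range simpleReflection)

/-- The Weyl group of the subalgebra `E₉`, generated by the simple reflections in
`α₀, …, α₈` (all but `α₋₁`). -/
def weylGroupE9 : Subgroup (Module.Dual ℝ Cartan ≃ₗ[ℝ] Module.Dual ℝ Cartan) :=
  Subgroup.closure (simpleReflection '' {i | i ≠ 0})

/-- The real roots: the roots which the Weyl group can move to a simple root. -/
def realRoots : Set (Module.Dual ℝ Cartan) :=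
  {γ | γ ∈ roots ∧ ∃ w ∈ weylGroup, ∃ i, w γ = simpleRoot i}

/-- The imaginary roots: the roots which are not real. -/
def imaginaryRoots : Set (Module.Dual ℝ Cartan) := roots \ realRoots

/-- The positive real roots. -/
def positiveRealRoots : Set (Module.Dual ℝ Cartan) := realRoots ∩ positiveRoots

/-- The roots at affine level `l`: those whose coefficient of `α₋₁` is `l`. -/
def rootsAtLevel (l : ℤ) : Set (Module.Dual ℝ Cartan) :=
  {γ | γ ∈ roots ∧ ∃ k : Fin 10 → ℤ, γ = latticeVector k ∧ k 0 = l}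

/-- The null root `δ = α₀ + 2α₁ + 3α₂ + 4α₃ + 5α₄ + 6α₅ + 4α₆ + 2α₇ + 3α₈`. -/
def delta : Module.Dual ℝ Cartan := latticeVector ![0, 1, 2, 3, 4, 5, 6, 4, 2, 3]

end E10

end

/-! The explicit statement is a descent in height. A root `γ` at affine level one has coefficient 1
at `α₋₁`, so it is positive. If `γ(αᵢ^∨) > 0` for some node `i` of `E₉`, then `rᵢ` lowers the height
and gives another root at level one, again positive; so the process ends at a `γ` with `γ(αᵢ^∨) ≤ 0`
on all of `E₉`. Weighting these integers with the marks of `δ` gives `(δ|γ) = -1`. The marks are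
positive and only that of `α₀` is 1, so `γ(α₀^∨) = -1` and the other pairings vanish. The Cartan
matrix is invertible, hence `γ = α₋₁ + nδ`; the case `n = 0` is a real root.

Conversely, an element of the Weyl group fixing `δ` and sending `α₁` to `α₁ + δ` makes every `nδ -
α₁` a real root. Root strings then show that `nδ` and `α₋₁ + nδ` are roots for `n ≥ 1`. The latter
has norm `2 - 2n`, while real roots have norm 2, so it is imaginary.

All this needs three facts about the algebra given by generators and relations. Roots have
coefficients of one sign (`exists_of_mem_roots`, from the triangular decomposition and the
independence of joint eigenspaces). The Weyl group permutes the roots (`weylGroup_mem_roots`, from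
local nilpotency and `𝔰𝔩₂`-theory). Simple roots are roots, that is, the generators survive the
relations (`genF_ne_zero`, from the action on an irreducible highest weight module). -/

namespace E10

/-! ### The root lattice -/

open Matrix in
/-- The action of a simple reflection on the coefficients of a vector of the root lattice. -/
def reflectCoeff (i : Fin 10) (k : Fin 10 → ℤ) : Fin 10 → ℤ :=
  k - Pi.single i ((cartanMatrix *ᵥ k) i)

/-- The quadratic form of the root lattice, `(γ|γ)`. -/
def normForm (k : Fin 10 → ℤ) : ℤ := k ⬝ᵥ cartanMatrix.mulVec k

theorem cartanMatrix_diag (i : Fin 10) : cartanMatrix i i = 2 := by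
  fin_cases i <;> rfl

theorem cartanMatrix_comm (i j : Fin 10) : cartanMatrix i j = cartanMatrix j i := by
  fin_cases i <;> fin_cases j <;> rfl

theorem cartanMatrix_offDiag {i j : Fin 10} (h : i ≠ j) :
    cartanMatrix i j = 0 ∨ cartanMatrix i j = -1 := by
  fin_cases i <;> fin_cases j <;> first | exact absurd rfl h | exact .inl rfl | exact .inr rfl

theorem cartanMatrix_transpose : cartanMatrix.transpose = cartanMatrix := by
  ext i j; exact cartanMatrix_comm j i

theorem latticeVector_add (k l : Fin 10 → ℤ) :
    latticeVector (k + l) = latticeVector k + latticeVector l := by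
  simp [latticeVector, add_smul, Finset.sum_add_distrib]

theorem latticeVector_neg (k : Fin 10 → ℤ) : latticeVector (-k) = -latticeVector k := by
  simp [latticeVector]

theorem latticeVector_sub (k l : Fin 10 → ℤ) :
    latticeVector (k - l) = latticeVector k - latticeVector l := by
  rw [sub_eq_add_neg, latticeVector_add, latticeVector_neg, sub_eq_add_neg]

theorem latticeVector_nsmul (n : ℕ) (k : Fin 10 → ℤ) :
    latticeVector (n • k) = n • latticeVector k := by
  simp only [latticeVector, Finset.smul_sum, Pi.smul_apply, smul_assoc]

theorem latticeVector_single (i : Fin 10) (c : ℤ) :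
    latticeVector (Pi.single i c) = c • simpleRoot i := by
  rw [latticeVector, Finset.sum_eq_single i] <;> simp +contextual

theorem simpleRoot_eq_latticeVector (i : Fin 10) :
    simpleRoot i = latticeVector (Pi.single i 1) := by
  rw [latticeVector_single, one_smul]

theorem latticeVector_simpleCoroot (k : Fin 10 → ℤ) (i : Fin 10) :
    latticeVector k (simpleCoroot i) = (cartanMatrix.mulVec k i : ℝ) := by
  simp [latticeVector, Matrix.mulVec, dotProduct, simpleRoot_simpleCoroot, mul_comm]

/-- The inverse of the Cartan matrix. -/
def cartanInverse : Matrix (Fin 10) (Fin 10) ℤ :=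
  !![  0,  -1,  -2,  -3,  -4,  -5,  -6,  -4,  -2,  -3;
      -1,  -2,  -4,  -6,  -8, -10, -12,  -8,  -4,  -6;
      -2,  -4,  -6,  -9, -12, -15, -18, -12,  -6,  -9;
      -3,  -6,  -9, -12, -16, -20, -24, -16,  -8, -12;
      -4,  -8, -12, -16, -20, -25, -30, -20, -10, -15;
      -5, -10, -15, -20, -25, -30, -36, -24, -12, -18;
      -6, -12, -18, -24, -30, -36, -42, -28, -14, -21;
      -4,  -8, -12, -16, -20, -24, -28, -18,  -9, -14;
      -2,  -4,  -6,  -8, -10, -12, -14,  -9,  -4,  -7;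
      -3,  -6,  -9, -12, -15, -18, -21, -14,  -7, -10]

theorem cartanInverse_mul : cartanInverse * cartanMatrix = 1 := by
  decide +kernel

theorem mulVec_cartanMatrix_injective : Function.Injective cartanMatrix.mulVec := by
  intro k l h
  have := congrArg cartanInverse.mulVec h
  simpa [Matrix.mulVec_mulVec, cartanInverse_mul] using this

theorem latticeVector_injective : Function.Injective latticeVector := by
  intro k l h
  refine mulVec_cartanMatrix_injective (funext fun i ↦ ?_)
  have := DFunLike.congr_fun h (simpleCoroot i)
  rw [latticeVector_simpleCoroot, latticeVector_simpleCoroot] at this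
  exact_mod_cast this

theorem dual_ext {γ γ' : Module.Dual ℝ Cartan}
    (h : ∀ i, γ (simpleCoroot i) = γ' (simpleCoroot i)) : γ = γ' := by
  refine LinearMap.pi_ext' fun i ↦ LinearMap.ext_ring ?_
  simpa [simpleCoroot] using h i

theorem simpleReflection_latticeVector (i : Fin 10) (k : Fin 10 → ℤ) :
    simpleReflection i (latticeVector k) = latticeVector (reflectCoeff i k) := by
  rw [simpleReflection_apply, reflectCoeff, latticeVector_sub, latticeVector_single,
    latticeVector_simpleCoroot]
  module

theorem normForm_reflectCoeff (i : Fin 10) (k : Fin 10 → ℤ) :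
    normForm (reflectCoeff i k) = normForm k := by
  have h : ∀ c : ℤ, k ⬝ᵥ cartanMatrix.mulVec (Pi.single i c) = cartanMatrix.mulVec k i * c := by
    intro c
    rw [Matrix.dotProduct_mulVec, ← Matrix.mulVec_transpose, cartanMatrix_transpose,
      dotProduct_single]
  have h' : ∀ c : ℤ, cartanMatrix.mulVec (Pi.single i c) i = 2 * c := by
    intro c
    simp [Matrix.mulVec, cartanMatrix_diag]
  simp only [normForm, reflectCoeff, Matrix.mulVec_sub, sub_dotProduct, dotProduct_sub,
    single_dotProduct, h, h']
  ring

theorem weylGroup_latticeVector {w : Module.Dual ℝ Cartan ≃ₗ[ℝ] Module.Dual ℝ Cartan}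
    (hw : w ∈ weylGroup) (k : Fin 10 → ℤ) :
    ∃ l, w (latticeVector k) = latticeVector l ∧ normForm l = normForm k := by
  induction hw using Subgroup.closure_induction'' generalizing k with
  | one => exact ⟨k, rfl, rfl⟩
  | mem _ h =>
    obtain ⟨i, rfl⟩ := h
    exact ⟨_, simpleReflection_latticeVector i k, normForm_reflectCoeff i k⟩
  | inv_mem _ h =>
    obtain ⟨i, rfl⟩ := h
    refine ⟨_, ?_, normForm_reflectCoeff i k⟩
    rw [← simpleReflection_latticeVector]
    exact congrArg (fun f : Module.Dual ℝ Cartan ≃ₗ[ℝ] Module.Dual ℝ Cartan ↦ f (latticeVector k))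
      (Module.reflection_symm _)
  | mul x y _ _ hx hy =>
    obtain ⟨l, hl, hlk⟩ := hy k
    obtain ⟨m, hm, hml⟩ := hx l
    exact ⟨m, by rw [LinearEquiv.mul_apply, hl, hm], hml.trans hlk⟩

/-- The Weyl group preserves the form and simple roots have norm 2. This is the criterion by which a
root is later recognised as imaginary. -/
theorem normForm_eq_two_of_mem_realRoots {k : Fin 10 → ℤ} (h : latticeVector k ∈ realRoots) :
    normForm k = 2 := by
  obtain ⟨-, w, hw, i, hi⟩ := h
  obtain ⟨l, hl, hlk⟩ := weylGroup_latticeVector hw k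
  rw [hi, simpleRoot_eq_latticeVector] at hl
  rw [← hlk, ← latticeVector_injective hl]
  simp [normForm, cartanMatrix_diag]

theorem weylGroupE9_le : weylGroupE9 ≤ weylGroup :=
  Subgroup.closure_mono (Set.image_subset_range _ _)

theorem simpleReflection_mem (i : Fin 10) : simpleReflection i ∈ weylGroup :=
  Subgroup.subset_closure ⟨i, rfl⟩

/-! ### Generators and relations -/

/-- The free Lie algebra on the generators of `E₁₀`. -/
abbrev Free : Type := FreeLieAlgebra ℂ (CartanMatrix.Generators (Fin 10))

/-- The ideal of the Chevalley-Serre relations. -/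
noncomputable abbrev relationsIdeal : LieIdeal ℂ Free := CartanMatrix.Relations.toIdeal ℂ cartanMatrix

/-- The quotient map from the free Lie algebra to `E₁₀`. -/
noncomputable def quotientMap : Free →ₗ⁅ℂ⁆ Algebra where
  toFun x := (LieSubmodule.Quotient.mk x : Free ⧸ relationsIdeal)
  map_add' _ _ := rfl
  map_smul' _ _ := rfl
  map_lie' := rfl

theorem quotientMap_surjective : Function.Surjective quotientMap :=
  LieSubmodule.Quotient.surjective_mk' relationsIdeal

theorem quotientMap_eq_zero {x : Free} : quotientMap x = 0 ↔ x ∈ relationsIdeal :=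
  LieSubmodule.Quotient.mk_eq_zero relationsIdeal

theorem quotientMap_relation {x : Free} (h : x ∈ CartanMatrix.Relations.toSet ℂ cartanMatrix) :
    quotientMap x = 0 :=
  quotientMap_eq_zero.2 (LieSubmodule.subset_lieSpan h)

/-- The generator `Eᵢ` of `E₁₀`. -/
noncomputable def genE (i : Fin 10) : Algebra := quotientMap (FreeLieAlgebra.of ℂ (.E i))

/-- The generator `Fᵢ` of `E₁₀`. -/
noncomputable def genF (i : Fin 10) : Algebra := quotientMap (FreeLieAlgebra.of ℂ (.F i))

theorem genH_eq (i : Fin 10) : genH i = quotientMap (FreeLieAlgebra.of ℂ (.H i)) := rfl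

theorem lie_genH_genH (i j : Fin 10) : ⁅genH i, genH j⁆ = 0 := by
  simp only [genH_eq, ← LieHom.map_lie]
  refine quotientMap_relation ?_
  simp only [CartanMatrix.Relations.toSet, Set.mem_union]
  exact .inl (.inl (.inl (.inl (.inl ⟨(i, j), rfl⟩))))

theorem lie_genE_genF (i j : Fin 10) : ⁅genE i, genF j⁆ = if i = j then genH i else 0 := by
  have h : quotientMap (CartanMatrix.Relations.EF ℂ (i, j)) = 0 := by
    refine quotientMap_relation ?_
    simp only [CartanMatrix.Relations.toSet, Set.mem_union]
    exact .inl (.inl (.inl (.inl (.inr ⟨(i, j), rfl⟩))))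
  simp only [CartanMatrix.Relations.EF, Function.uncurry_apply_pair, Function.comp_apply] at h
  split_ifs at h ⊢ with hij
  · subst hij
    rw [map_sub, LieHom.map_lie] at h
    exact sub_eq_zero.1 h
  · rwa [LieHom.map_lie] at h

theorem lie_genH_genE (i j : Fin 10) : ⁅genH i, genE j⁆ = cartanMatrix i j • genE j := by
  have h : quotientMap (CartanMatrix.Relations.HE ℂ cartanMatrix (i, j)) = 0 := by
    refine quotientMap_relation ?_
    simp only [CartanMatrix.Relations.toSet, Set.mem_union]
    exact .inl (.inl (.inl (.inr ⟨(i, j), rfl⟩)))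
  simp only [CartanMatrix.Relations.HE, Function.uncurry_apply_pair, Function.comp_apply] at h
  rw [map_sub, LieHom.map_lie, map_zsmul] at h
  exact sub_eq_zero.1 h

theorem lie_genH_genF (i j : Fin 10) : ⁅genH i, genF j⁆ = -(cartanMatrix i j • genF j) := by
  have h : quotientMap (CartanMatrix.Relations.HF ℂ cartanMatrix (i, j)) = 0 := by
    refine quotientMap_relation ?_
    simp only [CartanMatrix.Relations.toSet, Set.mem_union]
    exact .inl (.inl (.inr ⟨(i, j), rfl⟩))
  simp only [CartanMatrix.Relations.HF, Function.uncurry_apply_pair, Function.comp_apply] at h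
  rw [map_add, LieHom.map_lie, map_zsmul] at h
  exact eq_neg_of_add_eq_zero_left h

theorem quotientMap_ad_pow (x y : Free) (n : ℕ) :
    quotientMap ((LieAlgebra.ad ℂ Free x ^ n) y) =
      (LieAlgebra.ad ℂ Algebra (quotientMap x) ^ n) (quotientMap y) := by
  induction n with
  | zero => rfl
  | succ n ih => rw [pow_succ', pow_succ', Module.End.mul_apply, Module.End.mul_apply,
      LieAlgebra.ad_apply, LieAlgebra.ad_apply, LieHom.map_lie, ih]

theorem serre_genE (i j : Fin 10) :
    (LieAlgebra.ad ℂ Algebra (genE i) ^ (-cartanMatrix i j).toNat) ⁅genE i, genE j⁆ = 0 := by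
  have h : quotientMap (CartanMatrix.Relations.adE ℂ cartanMatrix (i, j)) = 0 := by
    refine quotientMap_relation ?_
    simp only [CartanMatrix.Relations.toSet, Set.mem_union]
    exact .inl (.inr ⟨(i, j), rfl⟩)
  simp only [CartanMatrix.Relations.adE, Function.uncurry_apply_pair, Function.comp_apply] at h
  rwa [quotientMap_ad_pow, LieHom.map_lie] at h

theorem serre_genF (i j : Fin 10) :
    (LieAlgebra.ad ℂ Algebra (genF i) ^ (-cartanMatrix i j).toNat) ⁅genF i, genF j⁆ = 0 := by
  have h : quotientMap (CartanMatrix.Relations.adF ℂ cartanMatrix (i, j)) = 0 := by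
    refine quotientMap_relation ?_
    simp only [CartanMatrix.Relations.toSet, Set.mem_union]
    exact .inr ⟨(i, j), rfl⟩
  simp only [CartanMatrix.Relations.adF, Function.uncurry_apply_pair, Function.comp_apply] at h
  rwa [quotientMap_ad_pow, LieHom.map_lie] at h

/-- By freeness the generators lift to a homomorphism into `K`; followed by the inclusion it fixes
the generators, so it is the identity. -/
theorem _root_.FreeLieAlgebra.lieSubalgebra_eq_top {R X : Type*} [CommRing R]
    (K : LieSubalgebra R (FreeLieAlgebra R X)) (h : ∀ x, FreeLieAlgebra.of R x ∈ K) : K = ⊤ := by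
  let s : FreeLieAlgebra R X →ₗ⁅R⁆ K := FreeLieAlgebra.lift R fun x ↦ ⟨_, h x⟩
  have hs : K.incl.comp s = LieHom.id := by
    ext x
    simp [s]
  rw [eq_top_iff]
  intro x _
  rw [← LieHom.id_apply (R := R) x, ← hs]
  exact (s x).2

theorem lieSubalgebra_eq_top (K : LieSubalgebra ℂ Algebra) (hH : ∀ i, genH i ∈ K)
    (hE : ∀ i, genE i ∈ K) (hF : ∀ i, genF i ∈ K) : K = ⊤ := by
  have h : K.comap quotientMap = ⊤ := by
    refine FreeLieAlgebra.lieSubalgebra_eq_top _ fun x ↦ ?_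
    rw [LieSubalgebra.mem_comap]
    cases x with
    | H i => exact hH i
    | E i => exact hE i
    | F i => exact hF i
  rw [eq_top_iff]
  intro x _
  obtain ⟨y, rfl⟩ := quotientMap_surjective x
  have : y ∈ K.comap quotientMap := h ▸ LieSubalgebra.mem_top y
  exact this

/-- A subspace which contains the generators and is stable under their adjoint action is the
whole algebra. -/
theorem submodule_eq_top (U : Submodule ℂ Algebra) (hH : ∀ i, genH i ∈ U)
    (hE : ∀ i, genE i ∈ U) (hF : ∀ i, genF i ∈ U) (hHU : ∀ i, ∀ x ∈ U, ⁅genH i, x⁆ ∈ U)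
    (hEU : ∀ i, ∀ x ∈ U, ⁅genE i, x⁆ ∈ U) (hFU : ∀ i, ∀ x ∈ U, ⁅genF i, x⁆ ∈ U) : U = ⊤ := by
  -- The stabilizer of `U` is a subalgebra containing the generators, hence everything. So `U` is an
  -- ideal, in particular a subalgebra, and it contains the generators too.
  let K : LieSubalgebra ℂ Algebra :=
    { carrier := {y | ∀ x ∈ U, ⁅y, x⁆ ∈ U}
      add_mem' := fun ha hb x hx ↦ by rw [add_lie]; exact U.add_mem (ha x hx) (hb x hx)
      zero_mem' := fun x _ ↦ by rw [zero_lie]; exact U.zero_mem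
      smul_mem' := fun c y hy x hx ↦ by rw [smul_lie]; exact U.smul_mem c (hy x hx)
      lie_mem' := fun ha hb x hx ↦ by
        rw [lie_lie]; exact U.sub_mem (ha _ (hb x hx)) (hb _ (ha x hx)) }
  have hK : K = ⊤ := lieSubalgebra_eq_top K hHU hEU hFU
  let K' : LieSubalgebra ℂ Algebra :=
    { U with
      lie_mem' := fun {a b} _ hb ↦ by
        have : a ∈ K := hK ▸ LieSubalgebra.mem_top a
        exact this b hb }
  have hK' : K' = ⊤ := lieSubalgebra_eq_top K' hH hE hF
  rw [eq_top_iff]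
  intro x _
  have : x ∈ K' := hK' ▸ LieSubalgebra.mem_top x
  exact this

/-! ### Local nilpotency -/

/-- The elements killed by a power of `ad Eᵢ` form the Engel subalgebra, so only the generators have
to be checked; for the `Eⱼ` this is the Serre relation. -/
theorem exists_ad_genE_pow_eq_zero (i : Fin 10) (x : Algebra) :
    ∃ n, (LieAlgebra.ad ℂ Algebra (genE i) ^ n) x = 0 := by
  rw [← LieSubalgebra.mem_engel_iff, lieSubalgebra_eq_top (LieSubalgebra.engel ℂ (genE i))]
  · exact LieSubalgebra.mem_top x
  · intro j
    rw [LieSubalgebra.mem_engel_iff]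
    refine ⟨2, ?_⟩
    rw [pow_two, Module.End.mul_apply, LieAlgebra.ad_apply, LieAlgebra.ad_apply,
      ← lie_skew (genE i) (genH j), lie_genH_genE, lie_neg, lie_zsmul, lie_self, smul_zero,
      neg_zero]
  · intro j
    rw [LieSubalgebra.mem_engel_iff]
    refine ⟨(-cartanMatrix i j).toNat + 1, ?_⟩
    rw [pow_succ, Module.End.mul_apply, LieAlgebra.ad_apply]
    exact serre_genE i j
  · intro j
    rw [LieSubalgebra.mem_engel_iff]
    -- The worst case is `j = i`: `Fᵢ ↦ Hᵢ ↦ -2Eᵢ ↦ 0`.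
    refine ⟨3, ?_⟩
    rw [pow_succ, pow_two, Module.End.mul_apply, Module.End.mul_apply, LieAlgebra.ad_apply,
      LieAlgebra.ad_apply, LieAlgebra.ad_apply, lie_genE_genF]
    split_ifs
    · rw [← lie_skew (genE i) (genH i), lie_genH_genE, lie_neg, lie_zsmul, lie_self, smul_zero,
        neg_zero]
    · simp

theorem exists_ad_genF_pow_eq_zero (i : Fin 10) (x : Algebra) :
    ∃ n, (LieAlgebra.ad ℂ Algebra (genF i) ^ n) x = 0 := by
  rw [← LieSubalgebra.mem_engel_iff, lieSubalgebra_eq_top (LieSubalgebra.engel ℂ (genF i))]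
  · exact LieSubalgebra.mem_top x
  · intro j
    rw [LieSubalgebra.mem_engel_iff]
    refine ⟨2, ?_⟩
    rw [pow_two, Module.End.mul_apply, LieAlgebra.ad_apply, LieAlgebra.ad_apply,
      ← lie_skew (genF i) (genH j), lie_genH_genF, neg_neg, lie_zsmul, lie_self, smul_zero]
  · intro j
    rw [LieSubalgebra.mem_engel_iff]
    refine ⟨3, ?_⟩
    rw [pow_succ, pow_two, Module.End.mul_apply, Module.End.mul_apply, LieAlgebra.ad_apply,
      LieAlgebra.ad_apply, LieAlgebra.ad_apply, ← lie_skew (genF i) (genE j), lie_genE_genF]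
    split_ifs with h
    · subst h
      rw [lie_neg, ← lie_skew (genF j) (genH j), lie_genH_genF, neg_neg, lie_neg, lie_zsmul,
        lie_self, smul_zero, neg_zero]
    · simp
  · intro j
    rw [LieSubalgebra.mem_engel_iff]
    refine ⟨(-cartanMatrix i j).toNat + 1, ?_⟩
    rw [pow_succ, Module.End.mul_apply, LieAlgebra.ad_apply]
    exact serre_genF i j

/-! ### Root spaces and the triangular decomposition -/

theorem cartanMap_simpleCoroot (i : Fin 10) : cartanMap (simpleCoroot i) = genH i := by
  rw [cartanMap, Finset.sum_eq_single i] <;> simp +contextual [simpleCoroot]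

theorem mem_rootSpace_iff {γ : Module.Dual ℝ Cartan} {x : Algebra} :
    x ∈ rootSpace γ ↔ ∀ i, ⁅genH i, x⁆ = ((γ (simpleCoroot i) : ℝ) : ℂ) • x := by
  refine ⟨fun h i ↦ by simpa [cartanMap_simpleCoroot] using h (simpleCoroot i), fun h t ↦ ?_⟩
  have ht : t = ∑ i, t i • simpleCoroot i := by
    simpa [simpleCoroot] using (Pi.basisFun ℝ (Fin 10)).sum_repr t |>.symm
  have hγ : ((γ t : ℝ) : ℂ) = ∑ i, ((t i : ℝ) : ℂ) * ((γ (simpleCoroot i) : ℝ) : ℂ) := by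
    conv_lhs => rw [ht]
    simp
  rw [hγ, cartanMap, sum_lie, Finset.sum_smul]
  exact Finset.sum_congr rfl fun i _ ↦ by rw [smul_lie, h i, smul_smul]

theorem mem_rootSpace_latticeVector_iff {k : Fin 10 → ℤ} {x : Algebra} :
    x ∈ rootSpace (latticeVector k) ↔
      ∀ i, ⁅genH i, x⁆ = ((cartanMatrix.mulVec k i : ℤ) : ℂ) • x := by
  simp only [mem_rootSpace_iff, latticeVector_simpleCoroot, Complex.ofReal_intCast]

theorem lie_mem_rootSpace {k l : Fin 10 → ℤ} {x y : Algebra}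
    (hx : x ∈ rootSpace (latticeVector k)) (hy : y ∈ rootSpace (latticeVector l)) :
    ⁅x, y⁆ ∈ rootSpace (latticeVector (k + l)) := by
  rw [mem_rootSpace_latticeVector_iff] at hx hy ⊢
  intro i
  rw [leibniz_lie, hx, hy, smul_lie, lie_smul, ← add_smul, Matrix.mulVec_add, Pi.add_apply,
    Int.cast_add]

theorem genE_mem_rootSpace (i : Fin 10) : genE i ∈ rootSpace (latticeVector (Pi.single i 1)) := by
  rw [mem_rootSpace_latticeVector_iff]
  intro j
  rw [lie_genH_genE, Int.cast_smul_eq_zsmul]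
  simp

theorem genF_mem_rootSpace (i : Fin 10) :
    genF i ∈ rootSpace (latticeVector (-Pi.single i 1)) := by
  rw [mem_rootSpace_latticeVector_iff]
  intro j
  rw [lie_genH_genF, Int.cast_smul_eq_zsmul]
  simp [Matrix.mulVec_neg]

theorem genH_mem_rootSpace (i : Fin 10) : genH i ∈ rootSpace (latticeVector 0) := by
  rw [mem_rootSpace_latticeVector_iff]
  intro j
  simp [lie_genH_genH]

/-- The iterated brackets of the generators `Eᵢ`, with their weights. -/
inductive IsWordE : (Fin 10 → ℤ) → Algebra → Prop
  | gen (i : Fin 10) : IsWordE (Pi.single i 1) (genE i)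
  | lie (i : Fin 10) {k : Fin 10 → ℤ} {x : Algebra} (h : IsWordE k x) :
      IsWordE (Pi.single i 1 + k) ⁅genE i, x⁆

/-- The iterated brackets of the generators `Fᵢ`, with their weights. -/
inductive IsWordF : (Fin 10 → ℤ) → Algebra → Prop
  | gen (i : Fin 10) : IsWordF (-Pi.single i 1) (genF i)
  | lie (i : Fin 10) {k : Fin 10 → ℤ} {x : Algebra} (h : IsWordF k x) :
      IsWordF (-Pi.single i 1 + k) ⁅genF i, x⁆

theorem IsWordE.mem_rootSpace {k : Fin 10 → ℤ} {x : Algebra} (h : IsWordE k x) :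
    x ∈ rootSpace (latticeVector k) := by
  induction h with
  | gen i => exact genE_mem_rootSpace i
  | lie i _ ih => exact lie_mem_rootSpace (genE_mem_rootSpace i) ih

theorem IsWordF.mem_rootSpace {k : Fin 10 → ℤ} {x : Algebra} (h : IsWordF k x) :
    x ∈ rootSpace (latticeVector k) := by
  induction h with
  | gen i => exact genF_mem_rootSpace i
  | lie i _ ih => exact lie_mem_rootSpace (genF_mem_rootSpace i) ih

theorem IsWordE.nonneg {k : Fin 10 → ℤ} {x : Algebra} (h : IsWordE k x) : 0 ≤ k := by
  induction h with
  | gen i => simp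
  | lie i _ ih => exact add_nonneg (by simp) ih

theorem IsWordF.nonpos {k : Fin 10 → ℤ} {x : Algebra} (h : IsWordF k x) : k ≤ 0 := by
  induction h with
  | gen i => simp
  | lie i _ ih => exact add_nonpos (by simp) ih

/-- The subalgebra `𝔫₊`, as a subspace. -/
noncomputable def spanE : Submodule ℂ Algebra := Submodule.span ℂ {x | ∃ k, IsWordE k x}

/-- The subalgebra `𝔫₋`, as a subspace. -/
noncomputable def spanF : Submodule ℂ Algebra := Submodule.span ℂ {x | ∃ k, IsWordF k x}

/-- The Cartan subalgebra, as a subspace. -/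
noncomputable def spanH : Submodule ℂ Algebra := Submodule.span ℂ (Set.range genH)

theorem lie_mem_of_span {s : Set Algebra} {U : Submodule ℂ Algebra} {y : Algebra}
    (h : ∀ x ∈ s, ⁅y, x⁆ ∈ U) : ∀ x ∈ Submodule.span ℂ s, ⁅y, x⁆ ∈ U := fun _ hx ↦
  (Submodule.span_le (p := U.comap (LieAlgebra.ad ℂ Algebra y))).2 h hx

theorem lie_mem_of_sup {P Q U : Submodule ℂ Algebra} {y : Algebra} (hP : ∀ x ∈ P, ⁅y, x⁆ ∈ U)
    (hQ : ∀ x ∈ Q, ⁅y, x⁆ ∈ U) : ∀ x ∈ P ⊔ Q, ⁅y, x⁆ ∈ U := fun _ hx ↦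
  (sup_le (c := U.comap (LieAlgebra.ad ℂ Algebra y)) hP hQ) hx

theorem lie_genH_mem_spanE (i : Fin 10) : ∀ x ∈ spanE, ⁅genH i, x⁆ ∈ spanE :=
  lie_mem_of_span fun x ⟨k, h⟩ ↦ by
    rw [mem_rootSpace_latticeVector_iff.1 h.mem_rootSpace]
    exact Submodule.smul_mem _ _ (Submodule.subset_span ⟨k, h⟩)

theorem lie_genH_mem_spanF (i : Fin 10) : ∀ x ∈ spanF, ⁅genH i, x⁆ ∈ spanF :=
  lie_mem_of_span fun x ⟨k, h⟩ ↦ by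
    rw [mem_rootSpace_latticeVector_iff.1 h.mem_rootSpace]
    exact Submodule.smul_mem _ _ (Submodule.subset_span ⟨k, h⟩)

theorem lie_genE_mem_spanE (i : Fin 10) : ∀ x ∈ spanE, ⁅genE i, x⁆ ∈ spanE :=
  lie_mem_of_span fun _ ⟨_, h⟩ ↦ Submodule.subset_span ⟨_, h.lie i⟩

theorem lie_genF_mem_spanF (i : Fin 10) : ∀ x ∈ spanF, ⁅genF i, x⁆ ∈ spanF :=
  lie_mem_of_span fun _ ⟨_, h⟩ ↦ Submodule.subset_span ⟨_, h.lie i⟩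

theorem lie_genE_mem_of_spanH (i : Fin 10) : ∀ x ∈ spanH, ⁅genE i, x⁆ ∈ spanE :=
  lie_mem_of_span <| Set.forall_mem_range.2 fun j ↦ by
    rw [← lie_skew, lie_genH_genE]
    exact spanE.neg_mem (spanE.smul_of_tower_mem _ (Submodule.subset_span ⟨_, .gen i⟩))

theorem lie_genF_mem_of_spanH (i : Fin 10) : ∀ x ∈ spanH, ⁅genF i, x⁆ ∈ spanF :=
  lie_mem_of_span <| Set.forall_mem_range.2 fun j ↦ by
    rw [← lie_skew, lie_genH_genF, neg_neg]
    exact spanF.smul_of_tower_mem _ (Submodule.subset_span ⟨_, .gen i⟩)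

theorem genH_mem_spanH (i : Fin 10) : genH i ∈ spanH := Submodule.subset_span ⟨i, rfl⟩

/-- Induction on the length of the word: moving `Eᵢ` past the letters produces only elements `Hᵢ`.
The Cartan part arises from words of length one alone. -/
theorem lie_genE_mem_of_spanF (i : Fin 10) : ∀ x ∈ spanF, ⁅genE i, x⁆ ∈ spanF ⊔ spanH := by
  refine lie_mem_of_span ?_
  rintro x ⟨k, h⟩
  induction h with
  | gen j =>
    rw [lie_genE_genF]
    split_ifs
    · exact Submodule.mem_sup_right (genH_mem_spanH i)
    · exact Submodule.zero_mem _
  | @lie j k x h ih =>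
    rw [leibniz_lie, lie_genE_genF]
    refine Submodule.mem_sup_left (spanF.add_mem ?_ ?_)
    · split_ifs
      · exact lie_genH_mem_spanF i x (Submodule.subset_span ⟨k, h⟩)
      · rw [zero_lie]; exact spanF.zero_mem
    · exact lie_mem_of_sup (lie_genF_mem_spanF j) (lie_genF_mem_of_spanH j) _ ih

theorem lie_genF_mem_of_spanE (i : Fin 10) : ∀ x ∈ spanE, ⁅genF i, x⁆ ∈ spanE ⊔ spanH := by
  refine lie_mem_of_span ?_
  rintro x ⟨k, h⟩
  induction h with
  | gen j =>
    rw [← lie_skew, lie_genE_genF]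
    split_ifs
    · exact Submodule.neg_mem _ (Submodule.mem_sup_right (genH_mem_spanH j))
    · rw [neg_zero]; exact Submodule.zero_mem _
  | @lie j k x h ih =>
    rw [leibniz_lie, ← lie_skew (genF i) (genE j), lie_genE_genF]
    refine Submodule.mem_sup_left (spanE.add_mem ?_ ?_)
    · split_ifs
      · rw [neg_lie]
        exact spanE.neg_mem (lie_genH_mem_spanE j x (Submodule.subset_span ⟨k, h⟩))
      · rw [neg_zero, zero_lie]; exact spanE.zero_mem
    · exact lie_mem_of_sup (lie_genE_mem_spanE j) (lie_genE_mem_of_spanH j) _ ih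

/-- The triangular decomposition. -/
theorem spanF_sup_spanH_sup_spanE : spanF ⊔ spanH ⊔ spanE = ⊤ := by
  have hF : spanF ≤ spanF ⊔ spanH ⊔ spanE := le_sup_left.trans le_sup_left
  have hH : spanH ≤ spanF ⊔ spanH ⊔ spanE := le_sup_right.trans le_sup_left
  have hE : spanE ≤ spanF ⊔ spanH ⊔ spanE := le_sup_right
  refine submodule_eq_top _ (fun i ↦ hH (genH_mem_spanH i))
    (fun i ↦ hE (Submodule.subset_span ⟨_, .gen i⟩))
    (fun i ↦ hF (Submodule.subset_span ⟨_, .gen i⟩)) (fun i ↦ ?_) (fun i ↦ ?_) (fun i ↦ ?_)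
  · refine lie_mem_of_sup (lie_mem_of_sup (fun x hx ↦ hF (lie_genH_mem_spanF i x hx)) ?_)
      fun x hx ↦ hE (lie_genH_mem_spanE i x hx)
    refine lie_mem_of_span <| Set.forall_mem_range.2 fun j ↦ ?_
    rw [lie_genH_genH]
    exact Submodule.zero_mem _
  · exact lie_mem_of_sup (lie_mem_of_sup
      (fun x hx ↦ le_sup_left (a := spanF ⊔ spanH) (lie_genE_mem_of_spanF i x hx))
      fun x hx ↦ hE (lie_genE_mem_of_spanH i x hx)) fun x hx ↦ hE (lie_genE_mem_spanE i x hx)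
  · exact lie_mem_of_sup (lie_mem_of_sup (fun x hx ↦ hF (lie_genF_mem_spanF i x hx))
      fun x hx ↦ hF (lie_genF_mem_of_spanH i x hx))
      fun x hx ↦ sup_le hE hH (lie_genF_mem_of_spanE i x hx)

theorem rootSpace_le_iInf (γ : Module.Dual ℝ Cartan) :
    rootSpace γ ≤ ⨅ i, (LieAlgebra.ad ℂ Algebra (genH i)).maxGenEigenspace
      ((γ (simpleCoroot i) : ℝ) : ℂ) := by
  refine le_iInf fun i x hx ↦ ?_
  rw [Module.End.mem_maxGenEigenspace]
  refine ⟨1, ?_⟩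
  rw [pow_one, LinearMap.sub_apply, LieAlgebra.ad_apply, mem_rootSpace_iff.1 hx i]
  simp

/-- Every root is a nonnegative or a nonpositive combination of the simple roots. -/
theorem exists_of_mem_roots {γ : Module.Dual ℝ Cartan} (h : γ ∈ roots) :
    ∃ k : Fin 10 → ℤ, γ = latticeVector k ∧ (0 ≤ k ∨ k ≤ 0) := by
  by_contra! hγ
  have hcomm : ∀ i j φ, Set.MapsTo (LieAlgebra.ad ℂ Algebra (genH i))
      ((LieAlgebra.ad ℂ Algebra (genH j)).maxGenEigenspace φ)
      ((LieAlgebra.ad ℂ Algebra (genH j)).maxGenEigenspace φ) := by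
    intro i j φ
    refine Module.End.mapsTo_maxGenEigenspace_of_comm ?_ φ
    ext x
    simp only [Module.End.mul_apply, LieAlgebra.ad_apply]
    rw [leibniz_lie, lie_genH_genH, zero_lie, zero_add]
  -- The commuting operators `ad Hᵢ` have independent joint generalized eigenspaces. If `γ` is not a
  -- weight of the triangular decomposition, the eigenspaces for the other weights already span
  -- everything, so the root space of `γ` vanishes.
  have hind := Module.End.independent_iInf_maxGenEigenspace_of_forall_mapsTo _ hcomm
  have hle : ∀ k : Fin 10 → ℤ, (0 ≤ k ∨ k ≤ 0) → rootSpace (latticeVector k) ≤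
      ⨆ (χ : Fin 10 → ℂ) (_ : χ ≠ fun i ↦ ((γ (simpleCoroot i) : ℝ) : ℂ)),
        ⨅ i, (LieAlgebra.ad ℂ Algebra (genH i)).maxGenEigenspace (χ i) := by
    intro k hk
    refine (rootSpace_le_iInf _).trans
      (le_iSup₂_of_le (fun i ↦ ((latticeVector k (simpleCoroot i) : ℝ) : ℂ)) ?_ le_rfl)
    intro heq
    have : γ = latticeVector k := dual_ext fun i ↦ by
      exact_mod_cast (congrFun heq i).symm
    have := hγ k this
    tauto
  have htop := spanF_sup_spanH_sup_spanE
  refine h.2 (le_bot_iff.1 (le_trans (le_inf (rootSpace_le_iInf γ) ?_)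
    (hind fun i ↦ ((γ (simpleCoroot i) : ℝ) : ℂ)).le_bot))
  refine le_top.trans (htop.ge.trans (sup_le (sup_le ?_ ?_) ?_))
  · exact Submodule.span_le.2 fun x ⟨k, hk⟩ ↦ hle k (.inr hk.nonpos) hk.mem_rootSpace
  · refine Submodule.span_le.2 (Set.range_subset_iff.2 fun i ↦ ?_)
    exact hle 0 (.inl le_rfl) (genH_mem_rootSpace i)
  · exact Submodule.span_le.2 fun x ⟨k, hk⟩ ↦ hle k (.inl hk.nonneg) hk.mem_rootSpace

end E10

/-! ### Locally nilpotent representations of `𝔰𝔩₂` -/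

section Sl2

variable {V : Type*} [AddCommGroup V] [Module ℂ V] {e f h : Module.End ℂ V}

theorem sl2_h_pow_f (hf : h * f = f * h - 2 * f) {x : V} {c : ℂ} (hx : h x = c • x) (n : ℕ) :
    h ((f ^ n) x) = (c - 2 * n) • (f ^ n) x := by
  induction n with
  | zero => simpa using hx
  | succ n ih =>
    have := LinearMap.congr_fun hf ((f ^ n) x)
    simp only [LinearMap.sub_apply, Module.End.mul_apply, ih, map_smul,
      Module.End.ofNat_apply] at this
    rw [pow_succ', Module.End.mul_apply, this]
    push_cast
    module

/-- Moving `e` through `f ^ (n + 1)` collects the weights `c, c - 2, …, c - 2n`, whose sum is `(n +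
1)(c - n)`. -/
theorem sl2_e_pow_f (ef : e * f = f * e + h) (hf : h * f = f * h - 2 * f) {x : V} {c : ℂ}
    (hx : h x = c • x) (n : ℕ) :
    e ((f ^ (n + 1)) x) = (f ^ (n + 1)) (e x) + ((n + 1) * (c - n)) • (f ^ n) x := by
  induction n with
  | zero =>
    have := LinearMap.congr_fun ef x
    simp only [LinearMap.add_apply, Module.End.mul_apply, hx] at this
    simpa using this
  | succ n ih =>
    have := LinearMap.congr_fun ef ((f ^ (n + 1)) x)
    simp only [LinearMap.add_apply, Module.End.mul_apply, ih, map_add, map_smul,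
      sl2_h_pow_f hf hx] at this
    rw [pow_succ' f (n + 1), Module.End.mul_apply, Module.End.mul_apply, this]
    have h' : f ((f ^ n) x) = (f ^ (n + 1)) x := by rw [pow_succ', Module.End.mul_apply]
    rw [h']
    push_cast
    module

/-- In a representation of `𝔰𝔩₂` on which `e` is locally nilpotent, `f ^ m` is injective on the
vectors of weight `m`. -/
theorem sl2_eq_zero_of_pow_f_eq_zero (ef : e * f = f * e + h) (hf : h * f = f * h - 2 * f)
    (he : h * e = e * h + 2 * e) (N m : ℕ) (x : V) (hx : h x = (m : ℂ) • x)
    (hN : (e ^ N) x = 0) (hm : (f ^ m) x = 0) : x = 0 := by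
  induction N generalizing m x with
  | zero => simpa using hN
  | succ N ih =>
    have hfs : (f ^ (m + 1)) x = 0 := by rw [pow_succ', Module.End.mul_apply, hm, map_zero]
    have hfs' : (f ^ (m + 2)) x = 0 := by rw [pow_succ', Module.End.mul_apply, hfs, map_zero]
    -- The vector `e x` has weight `m + 2` and is killed by `e ^ N`. It is killed by `f ^ (m + 2)`
    -- because `x` is killed by `f ^ (m + 1)` and `f ^ (m + 2)`. So the induction on `N` applies to
    -- it.
    have hex : e x = 0 := by
      refine ih (m + 2) (e x) ?_ ?_ ?_
      · have := LinearMap.congr_fun he x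
        simp only [LinearMap.add_apply, Module.End.mul_apply, hx, map_smul,
          Module.End.ofNat_apply] at this
        rw [this]
        push_cast
        module
      · rwa [pow_succ, Module.End.mul_apply] at hN
      · have := sl2_e_pow_f ef hf hx (m + 1)
        rw [hfs', hfs, map_zero, smul_zero, add_zero] at this
        exact this.symm
    -- Now `e x = 0`, so applying `e` to `f ^ (m - n) x = 0` gives `(m - n)(n + 1) f ^ (m - n - 1) x
    -- = 0` with a nonzero factor: the exponent descends to 0.
    have key : ∀ n, n ≤ m → (f ^ (m - n)) x = 0 := by
      intro n
      induction n with
      | zero => intro _; exact hm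
      | succ n ihn =>
        intro hn
        have := sl2_e_pow_f ef hf hx (m - (n + 1))
        rw [hex, map_zero, zero_add, show m - (n + 1) + 1 = m - n by omega, ihn (by omega),
          map_zero] at this
        refine (smul_eq_zero.1 this.symm).resolve_left (mul_ne_zero (Nat.cast_add_one_ne_zero _) ?_)
        rw [sub_ne_zero]
        exact_mod_cast (show m ≠ m - (n + 1) by omega)
    simpa using key m le_rfl

end Sl2

namespace E10

/-! ### The Weyl group acts on the roots -/

theorem ad_genE_mul_ad_genF (i : Fin 10) :
    LieAlgebra.ad ℂ Algebra (genE i) * LieAlgebra.ad ℂ Algebra (genF i) =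
      LieAlgebra.ad ℂ Algebra (genF i) * LieAlgebra.ad ℂ Algebra (genE i) +
        LieAlgebra.ad ℂ Algebra (genH i) := by
  ext x
  simp only [LinearMap.add_apply, Module.End.mul_apply, LieAlgebra.ad_apply]
  rw [leibniz_lie, lie_genE_genF, if_pos rfl, add_comm]

theorem ad_genH_mul_ad_genE (i : Fin 10) :
    LieAlgebra.ad ℂ Algebra (genH i) * LieAlgebra.ad ℂ Algebra (genE i) =
      LieAlgebra.ad ℂ Algebra (genE i) * LieAlgebra.ad ℂ Algebra (genH i) +
        2 * LieAlgebra.ad ℂ Algebra (genE i) := by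
  ext x
  simp only [LinearMap.add_apply, Module.End.mul_apply, LieAlgebra.ad_apply,
    Module.End.ofNat_apply]
  rw [leibniz_lie, lie_genH_genE, cartanMatrix_diag, two_smul, two_smul, add_lie, add_comm]

theorem ad_genH_mul_ad_genF (i : Fin 10) :
    LieAlgebra.ad ℂ Algebra (genH i) * LieAlgebra.ad ℂ Algebra (genF i) =
      LieAlgebra.ad ℂ Algebra (genF i) * LieAlgebra.ad ℂ Algebra (genH i) -
        2 * LieAlgebra.ad ℂ Algebra (genF i) := by
  ext x
  simp only [LinearMap.sub_apply, Module.End.mul_apply, LieAlgebra.ad_apply,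
    Module.End.ofNat_apply]
  rw [leibniz_lie, lie_genH_genF, cartanMatrix_diag, two_smul, two_smul, neg_lie, add_lie]
  abel

theorem ad_genF_pow_ne_zero {k : Fin 10 → ℤ} {x : Algebra}
    (hx : x ∈ rootSpace (latticeVector k)) (h0 : x ≠ 0) {i : Fin 10} {m : ℕ}
    (hm : cartanMatrix.mulVec k i = m) : (LieAlgebra.ad ℂ Algebra (genF i) ^ m) x ≠ 0 := by
  intro h
  obtain ⟨N, hN⟩ := exists_ad_genE_pow_eq_zero i x
  refine h0 (sl2_eq_zero_of_pow_f_eq_zero (ad_genE_mul_ad_genF i) (ad_genH_mul_ad_genF i)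
    (ad_genH_mul_ad_genE i) N m x ?_ hN h)
  rw [LieAlgebra.ad_apply, mem_rootSpace_latticeVector_iff.1 hx i, hm, Int.cast_natCast]

theorem ad_genE_pow_ne_zero {k : Fin 10 → ℤ} {x : Algebra}
    (hx : x ∈ rootSpace (latticeVector k)) (h0 : x ≠ 0) {i : Fin 10} {m : ℕ}
    (hm : cartanMatrix.mulVec k i = -m) : (LieAlgebra.ad ℂ Algebra (genE i) ^ m) x ≠ 0 := by
  intro h
  obtain ⟨N, hN⟩ := exists_ad_genF_pow_eq_zero i x
  -- The same lemma is used for the `𝔰𝔩₂`-triple with `Eᵢ` and `Fᵢ` exchanged and `Hᵢ` negated.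
  refine h0 (sl2_eq_zero_of_pow_f_eq_zero (h := -LieAlgebra.ad ℂ Algebra (genH i)) ?_ ?_ ?_
    N m x ?_ hN h)
  · rw [ad_genE_mul_ad_genF, add_neg_cancel_right]
  · rw [neg_mul, ad_genH_mul_ad_genE, mul_neg, neg_add, sub_eq_add_neg]
  · rw [neg_mul, ad_genH_mul_ad_genF, mul_neg, neg_sub']
    abel
  · rw [LinearMap.neg_apply, LieAlgebra.ad_apply, mem_rootSpace_latticeVector_iff.1 hx i, hm,
      Int.cast_neg, neg_smul, neg_neg, Int.cast_natCast]

theorem ad_pow_mem_rootSpace {k l : Fin 10 → ℤ} {x y : Algebra}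
    (hy : y ∈ rootSpace (latticeVector l)) (hx : x ∈ rootSpace (latticeVector k)) (n : ℕ) :
    (LieAlgebra.ad ℂ Algebra y ^ n) x ∈ rootSpace (latticeVector (k + n • l)) := by
  induction n with
  | zero => simpa using hx
  | succ n ih =>
    rw [pow_succ', Module.End.mul_apply, LieAlgebra.ad_apply,
      show k + (n + 1) • l = l + (k + n • l) by rw [succ_nsmul]; abel]
    exact lie_mem_rootSpace hy ih

/-- With `m = γ(αᵢ^∨)`, the element `(ad Fᵢ)^m` (or `(ad Eᵢ)^(-m)` when `m < 0`) carries a root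
vector of `γ` to a nonzero vector of weight `γ - mαᵢ`. -/
theorem simpleReflection_mem_roots {k : Fin 10 → ℤ} (h : latticeVector k ∈ roots) (i : Fin 10) :
    simpleReflection i (latticeVector k) ∈ roots := by
  obtain ⟨x, hx, h0⟩ := Submodule.exists_mem_ne_zero_of_ne_bot h.2
  refine ⟨by simpa using h.1, ?_⟩
  rw [simpleReflection_latticeVector, reflectCoeff]
  obtain ⟨m, hm | hm⟩ := Int.eq_nat_or_neg (cartanMatrix.mulVec k i)
  · refine (Submodule.ne_bot_iff _).2 ⟨_, ?_, ad_genF_pow_ne_zero hx h0 hm⟩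
    convert ad_pow_mem_rootSpace (genF_mem_rootSpace i) hx m using 3
    rw [hm, sub_eq_add_neg, smul_neg, ← Pi.single_smul]
    simp
  · refine (Submodule.ne_bot_iff _).2 ⟨_, ?_, ad_genE_pow_ne_zero hx h0 hm⟩
    convert ad_pow_mem_rootSpace (genE_mem_rootSpace i) hx m using 3
    rw [hm, sub_eq_add_neg, ← Pi.single_smul, ← Pi.single_neg]
    simp

theorem weylGroup_mem_roots {w : Module.Dual ℝ Cartan ≃ₗ[ℝ] Module.Dual ℝ Cartan}
    (hw : w ∈ weylGroup) {γ : Module.Dual ℝ Cartan} (h : γ ∈ roots) : w γ ∈ roots := by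
  have hs : ∀ i, ∀ γ ∈ roots, simpleReflection i γ ∈ roots := by
    intro i γ hγ
    obtain ⟨k, rfl, -⟩ := exists_of_mem_roots hγ
    exact simpleReflection_mem_roots hγ i
  induction hw using Subgroup.closure_induction'' generalizing γ with
  | one => exact h
  | mem _ hx =>
    obtain ⟨i, rfl⟩ := hx
    exact hs i γ h
  | inv_mem _ hx =>
    obtain ⟨i, rfl⟩ := hx
    exact hs i γ h
  | mul x y _ _ hx hy => exact hx (hy h)

/-- If `γ` is a root with `γ(αᵢ^∨) < 0`, then so is `γ + αᵢ`, unless it vanishes. -/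
theorem add_simpleRoot_mem_roots {k : Fin 10 → ℤ} (h : latticeVector k ∈ roots) {i : Fin 10}
    (hi : cartanMatrix.mulVec k i < 0) (hk : k + Pi.single i 1 ≠ 0) :
    latticeVector (k + Pi.single i 1) ∈ roots := by
  obtain ⟨x, hx, h0⟩ := Submodule.exists_mem_ne_zero_of_ne_bot h.2
  refine ⟨fun h' ↦ hk (latticeVector_injective (h'.trans (by simp [latticeVector]))), ?_⟩
  obtain ⟨m, hm⟩ := Int.exists_eq_neg_ofNat hi.le
  obtain ⟨n, rfl⟩ : ∃ n, m = n + 1 := Nat.exists_eq_succ_of_ne_zero (by omega)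
  refine (Submodule.ne_bot_iff _).2 ⟨⁅genE i, x⁆, ?_, fun h' ↦ ?_⟩
  · rw [add_comm]
    exact lie_mem_rootSpace (genE_mem_rootSpace i) hx
  -- Since the exponent is at least 1, the nonvanishing of the full power already forces `[Eᵢ, x] ≠
  -- 0`.
  · refine ad_genE_pow_ne_zero hx h0 hm ?_
    rw [pow_succ, Module.End.mul_apply, LieAlgebra.ad_apply, h', map_zero]

end E10

/-! ### The Serre elements commute with the opposite generators -/

section Serre

variable {L ι : Type*} [LieRing L] [DecidableEq ι] {E F H : ι → L} {c : ι → ι → ℤ}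

/-- Stated for abstract families, since it is applied both to `(E, F, H)` and to `(F, E, -H)`. -/
theorem lie_lie_eq_zero_of_cartan_eq_zero (hEF : ∀ i j, ⁅E i, F j⁆ = if i = j then H i else 0)
    (hHE : ∀ i j, ⁅H i, E j⁆ = c i j • E j) {i j : ι} (hij : c i j = 0) (hji : c j i = 0)
    (k : ι) : ⁅⁅E i, E j⁆, F k⁆ = 0 := by
  rw [lie_lie, hEF, hEF]
  split_ifs <;>
    simp [← lie_skew (E i) (H j), ← lie_skew (E j) (H i), hHE, hij, hji]

theorem lie_lie_eq_zero_of_cartan_eq_neg_one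
    (hEF : ∀ i j, ⁅E i, F j⁆ = if i = j then H i else 0)
    (hHE : ∀ i j, ⁅H i, E j⁆ = c i j • E j) {i j : ι} (hne : i ≠ j) (hii : c i i = 2)
    (hij : c i j = -1) (hji : c j i = -1) (k : ι) : ⁅⁅E i, ⁅E i, E j⁆⁆, F k⁆ = 0 := by
  rw [lie_lie, lie_lie, hEF, hEF]
  rcases eq_or_ne i k with rfl | hik
  -- For `k = i` the two contributions are `c i j • [Eᵢ, Eⱼ] = -[Eᵢ, Eⱼ]` and `(c i i + c i j) •
  -- [Eᵢ, Eⱼ] = [Eᵢ, Eⱼ]`. For `k = j` what remains is a multiple of `[Eᵢ, Eᵢ]`.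
  · rw [if_neg hne.symm, if_pos rfl, ← lie_skew ⁅E i, E j⁆ (H i), leibniz_lie (H i), hHE, hHE, hii, hij,
      ← lie_skew (E j) (H i), hHE, hij]
    simp only [lie_zero, two_smul, neg_smul, one_smul, neg_neg, zero_sub, add_lie, lie_neg]
    abel
  · rw [if_neg hik]
    rcases eq_or_ne j k with rfl | hjk
    · simp [← lie_skew (E i) (H j), hHE, hji]
    · simp [if_neg hjk]

variable {A : Type*} [Ring A] {E F H : ι → A}

theorem serre_mul_comm_of_cartan_eq_zero
    (hEF : ∀ i j, E i * F j = F j * E i + if i = j then H i else 0)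
    (hHE : ∀ i j, H i * E j = E j * H i + c i j • E j) {i j : ι} (hij : c i j = 0)
    (hji : c j i = 0) (k : ι) :
    (E i * E j - E j * E i) * F k = F k * (E i * E j - E j * E i) := by
  let _ : LieRing A := LieRing.ofAssociativeRing
  exact sub_eq_zero.1 (lie_lie_eq_zero_of_cartan_eq_zero (H := H) (c := c)
    (fun i j ↦ sub_eq_of_eq_add' (hEF i j)) (fun i j ↦ sub_eq_of_eq_add' (hHE i j)) hij hji k)

theorem serre_mul_comm_of_cartan_eq_neg_one
    (hEF : ∀ i j, E i * F j = F j * E i + if i = j then H i else 0)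
    (hHE : ∀ i j, H i * E j = E j * H i + c i j • E j) {i j : ι} (hne : i ≠ j)
    (hii : c i i = 2) (hij : c i j = -1) (hji : c j i = -1) (k : ι) :
    (E i * (E i * E j - E j * E i) - (E i * E j - E j * E i) * E i) * F k =
      F k * (E i * (E i * E j - E j * E i) - (E i * E j - E j * E i) * E i) := by
  let _ : LieRing A := LieRing.ofAssociativeRing
  exact sub_eq_zero.1 (lie_lie_eq_zero_of_cartan_eq_neg_one (H := H) (c := c)
    (fun i j ↦ sub_eq_of_eq_add' (hEF i j)) (fun i j ↦ sub_eq_of_eq_add' (hHE i j)) hne hii hij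
    hji k)

end Serre

namespace E10

/-! ### A free module on which the generators act nontrivially -/

/-- The free vector space on the words in the nodes of the Dynkin diagram: the Verma module, for
the algebra without the Serre relations, of the highest weight which is `1` on the simple coroots. -/
abbrev Verma : Type := List (Fin 10) →₀ ℂ

/-- The weight of a word. -/
def wordWeight (i : Fin 10) (w : List (Fin 10)) : ℤ := 1 - (w.map (cartanMatrix i)).sum

/-- The action of `Fᵢ`. -/
noncomputable def actF (i : Fin 10) : Module.End ℂ Verma := Finsupp.lmapDomain ℂ ℂ (List.cons i)

/-- The action of `Hᵢ`. -/
noncomputable def actH (i : Fin 10) : Module.End ℂ Verma :=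
  Finsupp.linearCombination ℂ fun w ↦ (wordWeight i w : ℂ) • Finsupp.single w 1

/-- The action of `Eᵢ` on the words. -/
noncomputable def wordE (i : Fin 10) : List (Fin 10) → Verma
  | [] => 0
  | j :: w => actF j (wordE i w) +
      if i = j then (wordWeight i w : ℂ) • Finsupp.single w 1 else 0

/-- The action of `Eᵢ`. -/
noncomputable def actE (i : Fin 10) : Module.End ℂ Verma := Finsupp.linearCombination ℂ (wordE i)

theorem actF_single (i : Fin 10) (w : List (Fin 10)) :
    actF i (Finsupp.single w 1) = Finsupp.single (i :: w) 1 := by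
  simp [actF]

theorem actH_single (i : Fin 10) (w : List (Fin 10)) :
    actH i (Finsupp.single w 1) = (wordWeight i w : ℂ) • Finsupp.single w 1 := by
  simp [actH]

theorem actE_single (i : Fin 10) (w : List (Fin 10)) :
    actE i (Finsupp.single w 1) = wordE i w := by
  simp [actE]

theorem verma_ext {V : Type*} [AddCommGroup V] [Module ℂ V] {f g : Verma →ₗ[ℂ] V}
    (h : ∀ w, f (Finsupp.single w 1) = g (Finsupp.single w 1)) : f = g :=
  Finsupp.lhom_ext' fun w ↦ LinearMap.ext_ring (h w)

theorem wordWeight_cons (i j : Fin 10) (w : List (Fin 10)) :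
    wordWeight i (j :: w) = wordWeight i w - cartanMatrix i j := by
  simp [wordWeight]; ring

theorem actE_mul_actF (i j : Fin 10) :
    actE i * actF j = actF j * actE i + if i = j then actH i else 0 := by
  refine verma_ext fun w ↦ ?_
  rw [LinearMap.add_apply, Module.End.mul_apply, Module.End.mul_apply, actF_single, actE_single,
    actE_single, wordE]
  split_ifs <;> simp [actH_single]

theorem actH_mul_actF (i j : Fin 10) :
    actH i * actF j = actF j * actH i - cartanMatrix i j • actF j := by
  refine verma_ext fun w ↦ ?_
  simp only [LinearMap.sub_apply, Module.End.mul_apply, actF_single, actH_single, map_smul,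
    LinearMap.smul_apply, wordWeight_cons]
  push_cast
  module

theorem actH_mul_actH (i j : Fin 10) : actH i * actH j = actH j * actH i := by
  refine verma_ext fun w ↦ ?_
  simp only [Module.End.mul_apply, actH_single, map_smul, smul_smul, mul_comm]

theorem actH_wordE (i j : Fin 10) (w : List (Fin 10)) :
    actH i (wordE j w) = ((wordWeight i w + cartanMatrix i j : ℤ) : ℂ) • wordE j w := by
  induction w with
  | nil => simp [wordE]
  | cons k w ih =>
    have h := LinearMap.congr_fun (actH_mul_actF i k) (wordE j w)
    simp only [LinearMap.sub_apply, Module.End.mul_apply, LinearMap.smul_apply, ih,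
      map_smul] at h
    rw [wordE, map_add, h, wordWeight_cons]
    split_ifs with hjk
    · subst hjk
      rw [map_smul, actH_single]
      push_cast
      module
    · rw [map_zero]
      push_cast
      module

theorem actH_mul_actE (i j : Fin 10) :
    actH i * actE j = actE j * actH i + cartanMatrix i j • actE j := by
  refine verma_ext fun w ↦ ?_
  simp only [LinearMap.add_apply, Module.End.mul_apply, actE_single, actH_single, map_smul,
    LinearMap.smul_apply, actH_wordE]
  push_cast
  module

/-! ### The radical of the Verma module -/

/-- The coefficient of the empty word. -/
noncomputable def counit : Verma →ₗ[ℂ] ℂ := Finsupp.lapply []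

theorem actF_mul_actE (i j : Fin 10) :
    actF i * actE j = actE j * actF i + if i = j then -actH i else 0 := by
  refine LinearMap.ext fun m ↦ ?_
  have h := LinearMap.congr_fun (actE_mul_actF j i) m
  rcases eq_or_ne i j with rfl | hne
  · simp only [if_true, LinearMap.add_apply, LinearMap.neg_apply, Module.End.mul_apply] at h ⊢
    rw [h, add_neg_cancel_right]
  · simpa [hne, hne.symm] using h.symm

theorem neg_actH_mul_actF (i j : Fin 10) :
    -actH i * actF j = actF j * -actH i + cartanMatrix i j • actF j := by
  refine LinearMap.ext fun m ↦ ?_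
  have h := LinearMap.congr_fun (actH_mul_actF i j) m
  simp only [LinearMap.sub_apply, LinearMap.add_apply, LinearMap.neg_apply, Module.End.mul_apply,
    LinearMap.smul_apply, map_neg] at h ⊢
  rw [h]
  abel

theorem counit_comp_actF (i : Fin 10) : counit ∘ₗ actF i = 0 := by
  refine verma_ext fun w ↦ ?_
  simp [counit, actF_single]

theorem counit_comp_actH (i : Fin 10) : counit ∘ₗ actH i = counit := by
  refine verma_ext fun w ↦ ?_
  cases w <;> simp [counit, actH_single, wordWeight]

/-- The functionals `m ↦ ε(Eᵢ₁ ⋯ Eᵢᵣ m)`, where `ε` is the coefficient of the empty word. -/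
noncomputable def wordFunctional : List (Fin 10) → Verma →ₗ[ℂ] ℂ
  | [] => counit
  | i :: w => wordFunctional w ∘ₗ actE i

/-- The span of the functionals `wordFunctional w`. -/
noncomputable def functionals : Submodule ℂ (Verma →ₗ[ℂ] ℂ) :=
  Submodule.span ℂ (Set.range wordFunctional)

theorem wordFunctional_mem (w : List (Fin 10)) : wordFunctional w ∈ functionals :=
  Submodule.subset_span ⟨w, rfl⟩

theorem comp_mem_functionals {T : Module.End ℂ Verma}
    (h : ∀ w, wordFunctional w ∘ₗ T ∈ functionals) : ∀ φ ∈ functionals, φ ∘ₗ T ∈ functionals :=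
  fun _ hφ ↦ (Submodule.span_le (p := functionals.comap (LinearMap.lcomp ℂ ℂ T))).2
    (Set.range_subset_iff.2 h) hφ

theorem comp_actE_mem (i : Fin 10) : ∀ φ ∈ functionals, φ ∘ₗ actE i ∈ functionals :=
  comp_mem_functionals fun w ↦ wordFunctional_mem (i :: w)

/-- Stability of the functionals under precomposition with the `Eᵢ`, `Hᵢ` and `Fᵢ` is what makes
their common kernel a submodule. `Hᵢ` and `Fᵢ` are commuted to the left past the `Eⱼ` until they
meet the counit. -/
theorem comp_actH_mem (i : Fin 10) : ∀ φ ∈ functionals, φ ∘ₗ actH i ∈ functionals := by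
  refine comp_mem_functionals fun w ↦ ?_
  induction w with
  | nil =>
    rw [wordFunctional, counit_comp_actH]
    exact wordFunctional_mem []
  | cons j w ih =>
    have h : wordFunctional (j :: w) ∘ₗ actH i = (wordFunctional w ∘ₗ actH i) ∘ₗ actE j -
        cartanMatrix i j • wordFunctional (j :: w) := by
      refine LinearMap.ext fun m ↦ ?_
      have := congrArg (wordFunctional w) (LinearMap.congr_fun (actH_mul_actE i j) m)
      simp only [LinearMap.add_apply, Module.End.mul_apply, map_add, LinearMap.smul_apply,
        map_zsmul] at this
      simp [wordFunctional, this]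
    rw [h]
    exact functionals.sub_mem (comp_actE_mem j _ ih)
      (functionals.smul_of_tower_mem _ (wordFunctional_mem _))

theorem comp_actF_mem (i : Fin 10) : ∀ φ ∈ functionals, φ ∘ₗ actF i ∈ functionals := by
  refine comp_mem_functionals fun w ↦ ?_
  induction w with
  | nil =>
    rw [wordFunctional, counit_comp_actF]
    exact functionals.zero_mem
  | cons j w ih =>
    have h : wordFunctional (j :: w) ∘ₗ actF i = (wordFunctional w ∘ₗ actF i) ∘ₗ actE j +
        if j = i then wordFunctional w ∘ₗ actH j else 0 := by
      refine LinearMap.ext fun m ↦ ?_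
      have := congrArg (wordFunctional w) (LinearMap.congr_fun (actE_mul_actF j i) m)
      simp only [LinearMap.add_apply, Module.End.mul_apply, map_add] at this
      split_ifs at this ⊢ <;> simpa [wordFunctional] using this
    rw [h]
    refine functionals.add_mem (comp_actE_mem j _ ih) ?_
    split_ifs
    · exact comp_actH_mem j _ (wordFunctional_mem w)
    · exact functionals.zero_mem

/-- The maximal proper submodule of the Verma module. -/
noncomputable def radical : Submodule ℂ Verma := functionals.dualCoannihilator

theorem mem_radical {m : Verma} : m ∈ radical ↔ ∀ φ ∈ functionals, φ m = 0 :=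
  Submodule.mem_dualCoannihilator _

/-- `T` can be moved to the left of all `Eᵢ`, where the counit kills it. The Serre elements in the
`Fᵢ` are of this kind. -/
theorem apply_mem_radical_of_commute {T : Module.End ℂ Verma} (h0 : counit ∘ₗ T = 0)
    (hT : ∀ i, actE i * T = T * actE i) (m : Verma) : T m ∈ radical := by
  have h : ∀ w, wordFunctional w ∘ₗ T = 0 := by
    intro w
    induction w with
    | nil => exact h0
    | cons i w ih =>
      rw [wordFunctional, LinearMap.comp_assoc, ← Module.End.mul_eq_comp, hT,
        Module.End.mul_eq_comp, ← LinearMap.comp_assoc, ih, LinearMap.zero_comp]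
  rw [mem_radical]
  intro φ hφ
  exact (Submodule.span_le (p := LinearMap.ker (LinearMap.applyₗ (T m)))).2
    (Set.range_subset_iff.2 fun w ↦ LinearMap.congr_fun (h w) m) hφ

/-- The empty word generates the module under the `Fᵢ`. The Serre elements in the `Eᵢ` are of this
kind, so they vanish before passing to the quotient. -/
theorem eq_zero_of_commute {T : Module.End ℂ Verma} (h0 : T (Finsupp.single [] 1) = 0)
    (hT : ∀ i, T * actF i = actF i * T) : T = 0 := by
  refine verma_ext fun w ↦ ?_
  induction w with
  | nil => simpa using h0
  | cons i w ih =>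
    have := LinearMap.congr_fun (hT i) (Finsupp.single w 1)
    rwa [Module.End.mul_apply, Module.End.mul_apply, ih, LinearMap.zero_apply, map_zero,
      actF_single] at this

/-! ### The relations of `E₁₀` hold on the irreducible quotient -/

section Representation

attribute [local instance] LieRing.ofAssociativeRing

/-- The action of the free Lie algebra on the Verma module. -/
noncomputable def action : Free →ₗ⁅ℂ⁆ Module.End ℂ Verma :=
  FreeLieAlgebra.lift ℂ fun
    | .H i => actH i
    | .E i => actE i
    | .F i => actF i

theorem action_H (i : Fin 10) : action (FreeLieAlgebra.of ℂ (.H i)) = actH i :=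
  FreeLieAlgebra.lift_of_apply _ _

theorem action_E (i : Fin 10) : action (FreeLieAlgebra.of ℂ (.E i)) = actE i :=
  FreeLieAlgebra.lift_of_apply _ _

theorem action_F (i : Fin 10) : action (FreeLieAlgebra.of ℂ (.F i)) = actF i :=
  FreeLieAlgebra.lift_of_apply _ _

theorem action_mem_radical (x : Free) : ∀ m ∈ radical, action x m ∈ radical := by
  let K : LieSubalgebra ℂ Free :=
    { carrier := {x | ∀ m ∈ radical, action x m ∈ radical}
      add_mem' := fun ha hb m hm ↦ by
        rw [map_add, LinearMap.add_apply]; exact radical.add_mem (ha m hm) (hb m hm)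
      zero_mem' := fun m _ ↦ by
        rw [map_zero, LinearMap.zero_apply]; exact radical.zero_mem
      smul_mem' := fun c x hx m hm ↦ by
        rw [map_smul, LinearMap.smul_apply]; exact radical.smul_mem c (hx m hm)
      lie_mem' := fun ha hb m hm ↦ by
        rw [LieHom.map_lie, Ring.lie_def, LinearMap.sub_apply]
        exact radical.sub_mem (ha _ (hb m hm)) (hb _ (ha m hm)) }
  have hT : ∀ {T : Module.End ℂ Verma}, (∀ φ ∈ functionals, φ ∘ₗ T ∈ functionals) →
      ∀ m ∈ radical, T m ∈ radical := by
    intro T hT m hm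
    rw [mem_radical] at hm ⊢
    exact fun φ hφ ↦ hm _ (hT φ hφ)
  have hK : K = ⊤ := by
    refine FreeLieAlgebra.lieSubalgebra_eq_top K fun x ↦ ?_
    cases x with
    | H i =>
      change ∀ m ∈ radical, action _ m ∈ radical
      rw [action_H]
      exact hT (comp_actH_mem i)
    | E i =>
      change ∀ m ∈ radical, action _ m ∈ radical
      rw [action_E]
      exact hT (comp_actE_mem i)
    | F i =>
      change ∀ m ∈ radical, action _ m ∈ radical
      rw [action_F]
      exact hT (comp_actF_mem i)
  have : x ∈ K := hK ▸ LieSubalgebra.mem_top x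
  exact this

/-- The annihilator of the irreducible quotient of the Verma module. -/
noncomputable def annihilator : LieIdeal ℂ Free where
  carrier := {x | ∀ m, action x m ∈ radical}
  add_mem' ha hb m := by
    rw [map_add, LinearMap.add_apply]; exact radical.add_mem (ha m) (hb m)
  zero_mem' m := by rw [map_zero, LinearMap.zero_apply]; exact radical.zero_mem
  smul_mem' c x hx m := by
    rw [map_smul, LinearMap.smul_apply]; exact radical.smul_mem c (hx m)
  lie_mem {x y} hy m := by
    rw [LieHom.map_lie, Ring.lie_def, LinearMap.sub_apply]
    exact radical.sub_mem (action_mem_radical x _ (hy m)) (hy _)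

theorem mem_annihilator {x : Free} : x ∈ annihilator ↔ ∀ m, action x m ∈ radical := Iff.rfl

theorem mem_annihilator_of_action_eq_zero {x : Free} (h : action x = 0) : x ∈ annihilator :=
  mem_annihilator.2 fun m ↦ by rw [h]; exact radical.zero_mem

theorem actE_single_nil (i : Fin 10) : actE i (Finsupp.single [] 1) = 0 := by
  rw [actE_single, wordE]

theorem counit_actF (i : Fin 10) (m : Verma) : counit (actF i m) = 0 :=
  LinearMap.congr_fun (counit_comp_actF i) m

theorem adE_mem_annihilator (i j : Fin 10) :
    CartanMatrix.Relations.adE ℂ cartanMatrix (i, j) ∈ annihilator := by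
  refine mem_annihilator_of_action_eq_zero ?_
  simp only [CartanMatrix.Relations.adE, Function.uncurry_apply_pair, Function.comp_apply]
  rcases eq_or_ne i j with rfl | hne
  · rw [lie_self, map_zero, map_zero]
  rcases cartanMatrix_offDiag hne with hij | hij
  · rw [hij, neg_zero, Int.toNat_zero, pow_zero, Module.End.one_apply, LieHom.map_lie, action_E,
      action_E]
    refine eq_zero_of_commute ?_ (serre_mul_comm_of_cartan_eq_zero actE_mul_actF actH_mul_actE
      hij ((cartanMatrix_comm j i).trans hij))
    simp [Ring.lie_def, actE_single_nil]
  · rw [hij, neg_neg, Int.toNat_one, pow_one, LieAlgebra.ad_apply, LieHom.map_lie,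
      LieHom.map_lie, action_E, action_E]
    refine eq_zero_of_commute ?_ (serre_mul_comm_of_cartan_eq_neg_one actE_mul_actF
      actH_mul_actE hne (cartanMatrix_diag i) hij ((cartanMatrix_comm j i).trans hij))
    simp [Ring.lie_def, actE_single_nil]

theorem adF_mem_annihilator (i j : Fin 10) :
    CartanMatrix.Relations.adF ℂ cartanMatrix (i, j) ∈ annihilator := by
  rw [mem_annihilator]
  simp only [CartanMatrix.Relations.adF, Function.uncurry_apply_pair, Function.comp_apply]
  rcases eq_or_ne i j with rfl | hne
  · rw [lie_self, map_zero, map_zero]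
    exact fun m ↦ radical.zero_mem
  rcases cartanMatrix_offDiag hne with hij | hij
  · rw [hij, neg_zero, Int.toNat_zero, pow_zero, Module.End.one_apply, LieHom.map_lie, action_F,
      action_F]
    refine apply_mem_radical_of_commute (LinearMap.ext fun m ↦ ?_) fun k ↦
      (serre_mul_comm_of_cartan_eq_zero actF_mul_actE neg_actH_mul_actF hij
        ((cartanMatrix_comm j i).trans hij) k).symm
    simp [Ring.lie_def, counit_actF]
  · rw [hij, neg_neg, Int.toNat_one, pow_one, LieAlgebra.ad_apply, LieHom.map_lie,
      LieHom.map_lie, action_F, action_F]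
    refine apply_mem_radical_of_commute (LinearMap.ext fun m ↦ ?_) fun k ↦
      (serre_mul_comm_of_cartan_eq_neg_one actF_mul_actE neg_actH_mul_actF hne
        (cartanMatrix_diag i) hij ((cartanMatrix_comm j i).trans hij) k).symm
    simp [Ring.lie_def, counit_actF]

theorem relationsIdeal_le_annihilator : relationsIdeal ≤ annihilator := by
  refine LieSubmodule.lieSpan_le.2 ?_
  rintro x (((((⟨⟨i, j⟩, rfl⟩ | ⟨⟨i, j⟩, rfl⟩) | ⟨⟨i, j⟩, rfl⟩) | ⟨⟨i, j⟩, rfl⟩) |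
    ⟨⟨i, j⟩, rfl⟩) | ⟨⟨i, j⟩, rfl⟩)
  · refine mem_annihilator_of_action_eq_zero ?_
    simp only [CartanMatrix.Relations.HH, Function.uncurry_apply_pair, Function.comp_apply]
    rw [LieHom.map_lie, action_H, action_H, Ring.lie_def, actH_mul_actH, sub_self]
  · refine mem_annihilator_of_action_eq_zero ?_
    simp only [CartanMatrix.Relations.EF, Function.uncurry_apply_pair, Function.comp_apply]
    split_ifs with h
    · rw [map_sub, LieHom.map_lie, action_E, action_F, action_H, Ring.lie_def]
      have := actE_mul_actF i i
      rw [if_pos rfl] at this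
      subst h
      exact sub_eq_zero.2 (sub_eq_of_eq_add' this)
    · rw [LieHom.map_lie, action_E, action_F, Ring.lie_def, actE_mul_actF, if_neg h, add_zero,
        sub_self]
  · refine mem_annihilator_of_action_eq_zero ?_
    simp only [CartanMatrix.Relations.HE, Function.uncurry_apply_pair, Function.comp_apply]
    rw [map_sub, LieHom.map_lie, map_zsmul, action_H, action_E, Ring.lie_def]
    exact sub_eq_zero.2 (sub_eq_of_eq_add' (actH_mul_actE i j))
  · refine mem_annihilator_of_action_eq_zero ?_
    simp only [CartanMatrix.Relations.HF, Function.uncurry_apply_pair, Function.comp_apply]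
    rw [map_add, LieHom.map_lie, map_zsmul, action_H, action_F, Ring.lie_def]
    refine LinearMap.ext fun m ↦ ?_
    have h := LinearMap.congr_fun (actH_mul_actF i j) m
    simp only [LinearMap.sub_apply, LinearMap.add_apply, LinearMap.zero_apply,
      Module.End.mul_apply] at h ⊢
    rw [h]
    abel
  · exact adE_mem_annihilator i j
  · exact adF_mem_annihilator i j

/-- On the highest weight vector `v`, `EᵢFᵢv = v`, because the highest weight is 1 on every coroot;
so `Fᵢv` is not in the radical. -/
theorem genF_ne_zero (i : Fin 10) : genF i ≠ 0 := by
  intro h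
  have hmem := relationsIdeal_le_annihilator (quotientMap_eq_zero.1 h)
  rw [mem_annihilator, action_F] at hmem
  have := mem_radical.1 (hmem (Finsupp.single [] 1)) _ (wordFunctional_mem [i])
  simp [wordFunctional, counit, actF_single, actE_single, wordE, wordWeight] at this

end Representation

/-- `-αᵢ` is a root because `Fᵢ ≠ 0`, and `rᵢ` exchanges it with `αᵢ`. -/
theorem simpleRoot_mem_roots (i : Fin 10) : simpleRoot i ∈ roots := by
  have h : latticeVector (-Pi.single i 1) ∈ roots := by
    refine ⟨fun h ↦ ?_, (Submodule.ne_bot_iff _).2 ⟨_, genF_mem_rootSpace i, genF_ne_zero i⟩⟩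
    have := congrFun (latticeVector_injective
      (h.trans (by simp [latticeVector] : (0 : Module.Dual ℝ Cartan) = latticeVector 0))) i
    simp at this
  have := simpleReflection_mem_roots h i
  rw [simpleReflection_latticeVector, reflectCoeff] at this
  convert this
  rw [simpleRoot_eq_latticeVector]
  congr 1
  ext j
  simp [Matrix.mulVec_neg, cartanMatrix_diag, Pi.single_apply]
  split_ifs <;> norm_num

/-! ### Real roots and the roots at affine level one -/

theorem simpleRoot_mem_realRoots (i : Fin 10) : simpleRoot i ∈ realRoots :=
  ⟨simpleRoot_mem_roots i, 1, one_mem _, i, rfl⟩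

theorem weylGroup_mem_realRoots {w : Module.Dual ℝ Cartan ≃ₗ[ℝ] Module.Dual ℝ Cartan}
    (hw : w ∈ weylGroup) {γ : Module.Dual ℝ Cartan} (h : γ ∈ realRoots) : w γ ∈ realRoots := by
  obtain ⟨hγ, v, hv, i, hi⟩ := h
  refine ⟨weylGroup_mem_roots hw hγ, v * w⁻¹, mul_mem hv (inv_mem hw), i, ?_⟩
  rw [LinearEquiv.mul_apply, ← LinearEquiv.mul_apply w⁻¹, inv_mul_cancel, LinearEquiv.coe_one,
    id, hi]

/-- The coefficients of `δ`. -/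
def deltaCoeff : Fin 10 → ℤ := ![0, 1, 2, 3, 4, 5, 6, 4, 2, 3]

theorem delta_eq : delta = latticeVector deltaCoeff := rfl

theorem mulVec_deltaCoeff : cartanMatrix.mulVec deltaCoeff = Pi.single 0 (-1) := by
  decide +kernel

/-- A word in the simple reflections of `E₉` which acts on the root lattice of `E₈ ⊕ ℤδ` as a
translation. -/
def translationWord : List (Fin 10) :=
  [2, 3, 2, 4, 3, 5, 4, 6, 5, 9, 6, 6, 7, 8, 5, 6, 7, 4, 5, 6, 9, 3, 4, 5, 6, 7, 2, 3, 4, 5, 6,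
    9, 8, 7, 6, 5, 4, 3, 1]

theorem foldr_reflectCoeff_deltaCoeff :
    translationWord.foldr reflectCoeff deltaCoeff = deltaCoeff := by
  decide +kernel

/-- The last letter acts first: `r₀` sends `α₁` to `α₀ + α₁ = δ + (α₁ - θ)`, with `θ = δ - α₀` the
highest root of `E₈`. The other letters belong to `E₈`; they fix `δ` and carry the root `α₁ - θ` to
`α₁`. -/
theorem foldr_reflectCoeff_single :
    translationWord.foldr reflectCoeff (Pi.single 2 1) = Pi.single 2 1 + deltaCoeff := by
  decide +kernel

theorem list_prod_latticeVector (l : List (Fin 10)) (k : Fin 10 → ℤ) :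
    (l.map simpleReflection).prod (latticeVector k) = latticeVector (l.foldr reflectCoeff k) := by
  induction l with
  | nil => rfl
  | cons i l ih =>
    rw [List.map_cons, List.prod_cons, LinearEquiv.mul_apply, ih, simpleReflection_latticeVector,
      List.foldr_cons]

theorem list_prod_mem_weylGroup (l : List (Fin 10)) :
    (l.map simpleReflection).prod ∈ weylGroup :=
  list_prod_mem <| List.forall_mem_map.2 fun i _ ↦ simpleReflection_mem i

theorem exists_weylGroup_translation :
    ∃ w ∈ weylGroup, w delta = delta ∧ w (simpleRoot 2) = simpleRoot 2 + delta := by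
  refine ⟨_, list_prod_mem_weylGroup translationWord, ?_, ?_⟩
  · rw [delta_eq, list_prod_latticeVector, foldr_reflectCoeff_deltaCoeff]
  · rw [simpleRoot_eq_latticeVector, list_prod_latticeVector, foldr_reflectCoeff_single,
      latticeVector_add, delta_eq]

theorem neg_simpleRoot_mem_realRoots (i : Fin 10) : -simpleRoot i ∈ realRoots := by
  have h := weylGroup_mem_realRoots (simpleReflection_mem i) (simpleRoot_mem_realRoots i)
  rw [simpleReflection_apply, simpleRoot_simpleCoroot, cartanMatrix_diag] at h
  convert h using 1
  push_cast
  module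

/-- The translation carries `(n + 1)δ - α₁` to `nδ - α₁`, so all of these lie in the orbit of `-α₁`.
-/
theorem nsmul_delta_sub_simpleRoot_mem_realRoots (n : ℕ) :
    n • delta - simpleRoot 2 ∈ realRoots := by
  induction n with
  | zero => simpa using neg_simpleRoot_mem_realRoots 2
  | succ n ih =>
    obtain ⟨w, hw, hδ, hα⟩ := exists_weylGroup_translation
    have h : w ((n + 1) • delta - simpleRoot 2) = n • delta - simpleRoot 2 := by
      rw [map_sub, map_nsmul, hδ, hα]
      module
    have := weylGroup_mem_realRoots (inv_mem hw) ih
    rwa [← h, ← LinearEquiv.mul_apply, inv_mul_cancel, LinearEquiv.coe_one, id] at this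

theorem foldr_reflectCoeff_single_two : [0, 1].foldr reflectCoeff (Pi.single 2 1) =
    Pi.single 0 1 + Pi.single 1 1 + Pi.single 2 1 := by
  decide +kernel

theorem simpleRoot_sum_mem_realRoots : simpleRoot 0 + simpleRoot 1 + simpleRoot 2 ∈ realRoots := by
  have h := weylGroup_mem_realRoots (list_prod_mem_weylGroup [0, 1]) (simpleRoot_mem_realRoots 2)
  rw [simpleRoot_eq_latticeVector 2, list_prod_latticeVector,
    foldr_reflectCoeff_single_two, latticeVector_add, latticeVector_add] at h
  simpa only [simpleRoot_eq_latticeVector] using h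

theorem simpleRoot_add_nsmul_delta_eq (n : ℕ) :
    simpleRoot 0 + n • delta = latticeVector (Pi.single 0 1 + n • deltaCoeff) := by
  rw [latticeVector_add, latticeVector_nsmul, simpleRoot_eq_latticeVector, delta_eq]

theorem nsmul_delta_sub_simpleRoot_eq (n : ℕ) :
    n • delta - simpleRoot 2 = latticeVector (n • deltaCoeff - Pi.single 2 1) := by
  rw [latticeVector_sub, latticeVector_nsmul, simpleRoot_eq_latticeVector, delta_eq]

theorem mulVec_nsmul_deltaCoeff (n : ℕ) :
    cartanMatrix.mulVec (n • deltaCoeff) = Pi.single 0 (-n : ℤ) := by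
  rw [Matrix.mulVec_smul, mulVec_deltaCoeff, ← Pi.single_smul]
  simp

/-- The root `nδ - α₁` takes the value `-2` on `α₁^∨`, so `α₁` can be added to it. Then `nδ` takes
the value `-n` on `α₋₁^∨`, which allows `α₋₁` to be added next. -/
theorem latticeVector_nsmul_deltaCoeff_mem_roots {n : ℕ} (hn : 1 ≤ n) :
    latticeVector (n • deltaCoeff) ∈ roots := by
  have h := (nsmul_delta_sub_simpleRoot_mem_realRoots n).1
  rw [nsmul_delta_sub_simpleRoot_eq] at h
  have := add_simpleRoot_mem_roots h (i := 2) ?_ ?_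
  · rwa [sub_add_cancel] at this
  · rw [Matrix.mulVec_sub, mulVec_nsmul_deltaCoeff]
    simp [cartanMatrix_diag]
  · rw [sub_add_cancel]
    intro h0
    have := congrFun h0 1
    simp [deltaCoeff] at this
    omega

theorem simpleRoot_add_nsmul_delta_mem_roots {n : ℕ} (hn : 1 ≤ n) :
    simpleRoot 0 + n • delta ∈ roots := by
  rw [simpleRoot_add_nsmul_delta_eq, add_comm]
  refine add_simpleRoot_mem_roots (latticeVector_nsmul_deltaCoeff_mem_roots hn) ?_ ?_
  · rw [mulVec_nsmul_deltaCoeff]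
    simp
    omega
  · intro h0
    have := congrFun h0 0
    simp [deltaCoeff] at this

theorem mulVec_single_zero :
    cartanMatrix.mulVec (Pi.single 0 1) = ![2, -1, 0, 0, 0, 0, 0, 0, 0, 0] := by
  decide +kernel

theorem normForm_single_add_nsmul_deltaCoeff (n : ℕ) :
    normForm (Pi.single 0 1 + n • deltaCoeff) = 2 - 2 * n := by
  rw [normForm, Matrix.mulVec_add, mulVec_nsmul_deltaCoeff,
    mulVec_single_zero]
  simp [dotProduct, Fin.sum_univ_succ, deltaCoeff]
  ring

theorem simpleRoot_add_nsmul_delta_mem {n : ℕ} (hn : 1 ≤ n) :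
    simpleRoot 0 + n • delta ∈ imaginaryRoots ∩ rootsAtLevel 1 := by
  have h := simpleRoot_add_nsmul_delta_mem_roots hn
  refine ⟨⟨h, fun hr ↦ ?_⟩, h, _, simpleRoot_add_nsmul_delta_eq n, by simp [deltaCoeff]⟩
  rw [simpleRoot_add_nsmul_delta_eq] at hr
  have := normForm_eq_two_of_mem_realRoots hr
  rw [normForm_single_add_nsmul_deltaCoeff] at this
  omega

theorem simpleRoot_sum_mem_positiveRealRoots :
    simpleRoot 0 + simpleRoot 1 + simpleRoot 2 ∈ positiveRealRoots := by
  refine ⟨simpleRoot_sum_mem_realRoots, simpleRoot_sum_mem_realRoots.1,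
    Pi.single 0 1 + Pi.single 1 1 + Pi.single 2 1, by decide +kernel, ?_⟩
  simp only [latticeVector_add, simpleRoot_eq_latticeVector]

theorem nsmul_delta_sub_simpleRoot_mem_positiveRealRoots {n : ℕ} (hn : 1 ≤ n) :
    n • delta - simpleRoot 2 ∈ positiveRealRoots := by
  refine ⟨nsmul_delta_sub_simpleRoot_mem_realRoots n,
    (nsmul_delta_sub_simpleRoot_mem_realRoots n).1, _, fun i ↦ ?_,
    nsmul_delta_sub_simpleRoot_eq n⟩
  fin_cases i <;> (simp [deltaCoeff]; try omega)

theorem simpleReflection_simpleRoot_add_nsmul_delta (n : ℕ) :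
    simpleReflection 1 (simpleRoot 0 + n • delta) =
      (simpleRoot 0 + simpleRoot 1 + simpleRoot 2) + (n • delta - simpleRoot 2) := by
  have h : reflectCoeff 1 (Pi.single 0 1 + n • deltaCoeff) =
      Pi.single 0 1 + n • deltaCoeff + Pi.single 1 1 := by
    rw [reflectCoeff, Matrix.mulVec_add, mulVec_nsmul_deltaCoeff, Pi.add_apply,
      show cartanMatrix.mulVec (Pi.single 0 1) 1 = -1 by decide +kernel, sub_eq_add_neg,
      ← Pi.single_neg]
    simp
  rw [simpleRoot_add_nsmul_delta_eq, simpleReflection_latticeVector, h, latticeVector_add,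
    ← simpleRoot_add_nsmul_delta_eq, ← simpleRoot_eq_latticeVector]
  abel

/-! ### Descent at affine level one -/

/-- A vector at affine level one which is antidominant for `E₉` is `α₋₁ + nδ`. -/
theorem eq_single_add_nsmul_deltaCoeff {k : Fin 10 → ℤ} (hk : 0 ≤ k) (h1 : k 0 = 1)
    (h : ∀ i, i ≠ 0 → cartanMatrix.mulVec k i ≤ 0) :
    k = Pi.single 0 1 + (k 1).toNat • deltaCoeff := by
  have hn : ((k 1).toNat : ℤ) = k 1 := Int.toNat_of_nonneg (hk 1)
  -- The pairing with `α₋₁^∨` identifies `n` as the coefficient of `α₀`.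
  have h0 : cartanMatrix.mulVec k 0 = 2 - k 1 := by
    simp [cartanMatrix, Matrix.mulVec, dotProduct, Fin.sum_univ_succ, h1]
    ring
  have hsum : deltaCoeff ⬝ᵥ cartanMatrix.mulVec k = -1 := by
    rw [Matrix.dotProduct_mulVec, ← Matrix.mulVec_transpose, cartanMatrix_transpose,
      mulVec_deltaCoeff, single_dotProduct, h1, neg_one_mul]
  refine mulVec_cartanMatrix_injective ?_
  rw [Matrix.mulVec_add, mulVec_nsmul_deltaCoeff, hn, mulVec_single_zero]
  have e1 := h 1 (by decide)
  have e2 := h 2 (by decide)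
  have e3 := h 3 (by decide)
  have e4 := h 4 (by decide)
  have e5 := h 5 (by decide)
  have e6 := h 6 (by decide)
  have e7 := h 7 (by decide)
  have e8 := h 8 (by decide)
  have e9 := h 9 (by decide)
  generalize cartanMatrix.mulVec k = s at *
  simp [deltaCoeff, dotProduct, Fin.sum_univ_succ] at hsum
  ext i
  -- Nonpositive integers with positive weights sum to `-1`, so exactly one is nonzero; it equals
  -- `-1` and has weight 1, which singles out `α₀`.
  fin_cases i <;> simp <;> omega

theorem sum_reflectCoeff (i : Fin 10) (k : Fin 10 → ℤ) :
    ∑ j, reflectCoeff i k j = ∑ j, k j - cartanMatrix.mulVec k i := by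
  simp [reflectCoeff, Finset.sum_sub_distrib]

/-- Every root at affine level one is equivalent under the Weyl group of `E₉` to some
`α₋₁ + nδ`. -/
theorem exists_weylGroupE9_apply_eq (N : ℕ) : ∀ k : Fin 10 → ℤ, latticeVector k ∈ roots →
    k 0 = 1 → ∑ i, k i = N →
    ∃ v ∈ weylGroupE9, ∃ n : ℕ, v (latticeVector k) = simpleRoot 0 + n • delta := by
  have hpos : ∀ k : Fin 10 → ℤ, latticeVector k ∈ roots → k 0 = 1 → 0 ≤ k := by
    intro k hk h1
    obtain ⟨l, hl, h | h⟩ := exists_of_mem_roots hk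
    · rwa [latticeVector_injective hl]
    · rw [← latticeVector_injective hl] at h
      have : k 0 ≤ 0 := h 0
      omega
  induction N using Nat.strong_induction_on with
  | _ N ih =>
    intro k hk h1 hN
    by_cases h : ∀ i, i ≠ 0 → cartanMatrix.mulVec k i ≤ 0
    · refine ⟨1, one_mem _, (k 1).toNat, ?_⟩
      rw [simpleRoot_add_nsmul_delta_eq, ← eq_single_add_nsmul_deltaCoeff (hpos k hk h1) h1 h]
      rfl
    -- The reflection lowers the height by the positive number `γ(αᵢ^∨)` and leaves the coefficient
    -- of `α₋₁` alone. The height stays nonnegative because the new root is again positive, so the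
    -- induction applies.
    · push Not at h
      obtain ⟨i, hi0, hi⟩ := h
      have hr : latticeVector (reflectCoeff i k) ∈ roots := by
        rw [← simpleReflection_latticeVector]
        exact simpleReflection_mem_roots hk i
      have hr1 : reflectCoeff i k 0 = 1 := by
        simp [reflectCoeff, h1, hi0.symm]
      have hsum := sum_reflectCoeff i k
      have h0 : 0 ≤ ∑ j, reflectCoeff i k j := Finset.sum_nonneg fun j _ ↦ hpos _ hr hr1 j
      obtain ⟨M, hM⟩ := Int.eq_ofNat_of_zero_le h0
      obtain ⟨v, hv, n, hn⟩ := ih M (by omega) _ hr hr1 hM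
      refine ⟨v * simpleReflection i, mul_mem hv (Subgroup.subset_closure ⟨i, hi0, rfl⟩), n, ?_⟩
      rw [LinearEquiv.mul_apply, simpleReflection_latticeVector, hn]

theorem exists_weylGroupE9_of_imaginary {γ : Module.Dual ℝ Cartan}
    (h : γ ∈ imaginaryRoots ∩ rootsAtLevel 1) :
    ∃ v ∈ weylGroupE9, ∃ n : ℕ, 1 ≤ n ∧ v γ = simpleRoot 0 + n • delta := by
  obtain ⟨⟨hγ, him⟩, -, k, rfl, h1⟩ := h
  have h0 : 0 ≤ ∑ i, k i := by
    obtain ⟨l, hl, h | h⟩ := exists_of_mem_roots hγ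
    · rw [latticeVector_injective hl]
      exact Finset.sum_nonneg fun i _ ↦ h i
    · rw [← latticeVector_injective hl] at h
      have : k 0 ≤ 0 := h 0
      omega
  obtain ⟨N, hN⟩ := Int.eq_ofNat_of_zero_le h0
  obtain ⟨v, hv, n, hn⟩ := exists_weylGroupE9_apply_eq N k hγ h1 hN
  -- If `n = 0`, then `v` moves `γ` to the simple root `α₋₁` and `γ` is real.
  refine ⟨v, hv, n, Nat.one_le_iff_ne_zero.2 fun hn0 ↦ him ⟨hγ, v, weylGroupE9_le hv, 0, ?_⟩, hn⟩
  rw [hn, hn0, zero_smul, add_zero]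

end E10

theorem mainTheorem5 :
    (∀ γ ∈ E10.imaginaryRoots ∩ E10.rootsAtLevel 1,
      ∃ w ∈ E10.weylGroup, ∃ α ∈ E10.positiveRealRoots, ∃ β ∈ E10.positiveRealRoots,
        w γ = α + β) ∧
    (∀ γ ∈ E10.imaginaryRoots ∩ E10.rootsAtLevel 1,
      ∃ v ∈ E10.weylGroupE9, ∃ n : ℕ, 1 ≤ n ∧ v γ = E10.simpleRoot 0 + n • E10.delta) ∧
    (∀ n : ℕ, 1 ≤ n →
      E10.simpleRoot 0 + n • E10.delta ∈ E10.imaginaryRoots ∩ E10.rootsAtLevel 1 ∧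
      E10.simpleRoot 0 + E10.simpleRoot 1 + E10.simpleRoot 2 ∈ E10.positiveRealRoots ∧
      n • E10.delta - E10.simpleRoot 2 ∈ E10.positiveRealRoots ∧
      E10.simpleReflection 1 (E10.simpleRoot 0 + n • E10.delta) =
        (E10.simpleRoot 0 + E10.simpleRoot 1 + E10.simpleRoot 2) +
          (n • E10.delta - E10.simpleRoot 2)) := by
  refine ⟨fun γ hγ ↦ ?_, fun γ hγ ↦ E10.exists_weylGroupE9_of_imaginary hγ, fun n hn ↦
    ⟨E10.simpleRoot_add_nsmul_delta_mem hn, E10.simpleRoot_sum_mem_positiveRealRoots,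
      E10.nsmul_delta_sub_simpleRoot_mem_positiveRealRoots hn,
      E10.simpleReflection_simpleRoot_add_nsmul_delta n⟩⟩
  obtain ⟨v, hv, n, hn, hvγ⟩ := E10.exists_weylGroupE9_of_imaginary hγ
  refine ⟨E10.simpleReflection 1 * v,
    mul_mem (E10.simpleReflection_mem 1) (E10.weylGroupE9_le hv), _,
    E10.simpleRoot_sum_mem_positiveRealRoots, _,
    E10.nsmul_delta_sub_simpleRoot_mem_positiveRealRoots hn, ?_⟩
  rw [LinearEquiv.mul_apply, hvγ, E10.simpleReflection_simpleRoot_add_nsmul_delta]
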